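/- Let $p\in\mathbb C$ with $0<|p|<1$, let $\omega=e^{2\pi i/3}$, and let $\theta(x;q)=\prod_{j=0}^\infty(1-q^jx)(1-q^{j+1}/x)$ for $0<|q|<1$, $x\in\mathbb C^\ast=\mathbb C\setminus\{0\}$, with the abbreviations $\theta(a_1,\dots,a_k;q)=\prod_i\theta(a_i;q)$, $\theta(v,\pm pv;q)=\theta(v,pv,-pv;q)$ and $\theta(u^3t^{\pm3};q)=\theta(u^3t^3,u^3t^{-3};q)$. A $BC_m$ theta function of nome $q$ is a holomorphic function $f$ on $\mathbb C^\ast$ with $f(qx)=q^{-m}x^{-2m-1}f(x)$ and $f(x^{-1})=-x^{-1}f(x)$. Let $V_n$ be the complex vector space of all $BC_{3n+1}$ theta functions $\psi$ of nome $p^2$ such that $\sum_{k=0}^2\omega^k\psi(\omega^kt)=0$ for all $t\in\mathbb C^\ast$. Let $n\ge 1$. Fix a basis $\psi_1,\psi_2,\psi_3$ of $V_1$, put $\Psi_1(t_1,t_2,t_3)=\det_{1\le i,j\le 3}(\psi_j(t_i))$ and, more generally, $$\Psi_n(t_1,\dots,t_n,u_1,\dots,u_n,v)=\frac{\prod_{i,j=1}^nu_j^{-3}\theta(u_j^3t_i^{\pm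 3};p^6)}{\theta(v,\pm pv;p^2)^{n-1}}\det_{1\leq i,j\leq n}\left(\frac{\Psi_1(t_i,u_j,v)}{u_j^{-3}\theta(u_j^3t_i^{\pm 3};p^6)}\right)$$ at the points of $(\mathbb C^\ast)^{2n+1}$ where all denominators are non-zero. These points form a dense subset of $(\mathbb C^\ast)^{2n+1}$, and the formula extends by continuity to a function $\Psi_n$ on all of $(\mathbb C^\ast)^{2n+1}$. Let $(\psi^{(n)}_j)_{j=1}^{2n+1}$ be a basis of $V_n$. Then there is a constant $C\in\mathbb C$, independent of all the variables, such that $$\Psi_n(t_1,\dots,t_{2n+1})=C\det_{1\leq i,j\leq 2n+1}(\psi_j^{(n)}(t_i))\qquad\text{for all }t_1,\dots,t_{2n+1}\in\mathbb C^\ast.$$ In particular, $\Psi_n$ is anti-symmetric in all $2n+1$ variables: $\Psi_n(t_{\sigma(1)},\dots,t_{\sigma(2n+1)})=\operatorname{sgn}(\sigma)\,\Psi_n(t_1,\dots,t_{2n+1})$ for every permutation $\sigma$ of $\{1,\dots,2n+1\}$. -/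

import Mathlib

noncomputable section

/-- The theta function `θ(x; q) = ∏_{j ≥ 0} (1 - q ^ j x) (1 - q ^ (j + 1) / x)`,
for `‖q‖ < 1` and `x ≠ 0`. -/
def ellTheta (q x : ℂ) : ℂ :=
  ∏' j : ℕ, ((1 - q ^ j * x) * (1 - q ^ (j + 1) / x))

/-- The cubic root of unity `exp (2 π i / 3)`. -/
def cubicRoot : ℂˣ :=
  Units.mk0 (Complex.exp (2 * Real.pi * Complex.I / 3)) (Complex.exp_ne_zero _)

/-- Holomorphic functions on the punctured plane `ℂˣ`. -/
def HolomorphicOnUnits (f : ℂˣ → ℂ) : Prop :=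
  ∃ F : ℂ → ℂ, DifferentiableOn ℂ F {0}ᶜ ∧ ∀ z : ℂˣ, F z = f z

/-- `f` is a `BC_m` theta function of nome `q`. -/
structure IsBCTheta (m : ℕ) (q : ℂˣ) (f : ℂˣ → ℂ) : Prop where
  holomorphic : HolomorphicOnUnits f
  quasiperiodic : ∀ x : ℂˣ, f (q * x) = 1 / ((q : ℂ) ^ m * (x : ℂ) ^ (2 * m + 1)) * f x
  inversion : ∀ x : ℂˣ, f x⁻¹ = -(x : ℂ)⁻¹ * f x

/-- The space `V_n` of `BC_{3n+1}` theta functions `f` of nome `p ^ 2` such that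
`f(t) + ω f(ω t) + ω ^ 2 f(ω ^ 2 t) = 0`, where `ω = exp (2 π i / 3)`. -/
def thetaSpace (p : ℂˣ) (n : ℕ) : Submodule ℂ (ℂˣ → ℂ) where
  carrier := {f | IsBCTheta (3 * n + 1) (p ^ 2) f ∧
    ∀ t : ℂˣ, ∑ k ∈ Finset.range 3, (cubicRoot : ℂ) ^ k * f (cubicRoot ^ k * t) = 0}
  zero_mem' := by
    refine ⟨⟨⟨fun _ => 0, differentiableOn_const _, fun _ => rfl⟩, ?_, ?_⟩, ?_⟩ <;>
      intro x <;> simp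
  add_mem' := by
    rintro f g ⟨⟨⟨F, hF, hFf⟩, hf1, hf2⟩, hf3⟩ ⟨⟨⟨G, hG, hGg⟩, hg1, hg2⟩, hg3⟩
    refine ⟨⟨⟨fun z => F z + G z, hF.add hG, fun z => ?_⟩, fun x => ?_, fun x => ?_⟩,
      fun t => ?_⟩
    · simp [hFf, hGg]
    · rw [Pi.add_apply, hf1, hg1, Pi.add_apply]; ring
    · rw [Pi.add_apply, hf2, hg2, Pi.add_apply]; ring
    · simp only [Pi.add_apply, mul_add, Finset.sum_add_distrib, hf3, hg3, add_zero]
  smul_mem' := by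
    rintro c f ⟨⟨⟨F, hF, hFf⟩, hf1, hf2⟩, hf3⟩
    refine ⟨⟨⟨fun z => c * F z, hF.const_mul c, fun z => ?_⟩, fun x => ?_, fun x => ?_⟩,
      fun t => ?_⟩
    · simp [hFf]
    · rw [Pi.smul_apply, hf1, Pi.smul_apply, smul_eq_mul, smul_eq_mul]; ring
    · rw [Pi.smul_apply, hf2, Pi.smul_apply, smul_eq_mul, smul_eq_mul]; ring
    · have h := hf3 t
      simp only [Pi.smul_apply, smul_eq_mul, mul_left_comm _ c]
      rw [← Finset.mul_sum, h, mul_zero]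

/-- The alternant `det (ψ_j (x_i))`. -/
def alternant {m : ℕ} (ψ : Fin m → ℂˣ → ℂ) (x : Fin m → ℂˣ) : ℂ :=
  (Matrix.of fun i j : Fin m => ψ j (x i)).det

/-- `u⁻³ θ(u³ t³; p⁶) θ(u³ t⁻³; p⁶)`. -/
def cauchyDenom (p t u : ℂˣ) : ℂ :=
  ((u : ℂ) ^ 3)⁻¹ * (ellTheta ((p : ℂ) ^ 6) ((u : ℂ) ^ 3 * (t : ℂ) ^ 3) *
    ellTheta ((p : ℂ) ^ 6) ((u : ℂ) ^ 3 * ((t : ℂ) ^ 3)⁻¹))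

/-- `θ(v; p²) θ(p v; p²) θ(-p v; p²)`. -/
def trivialFactor (p v : ℂˣ) : ℂ :=
  ellTheta ((p : ℂ) ^ 2) v * ellTheta ((p : ℂ) ^ 2) (p * v) * ellTheta ((p : ℂ) ^ 2) (-(p * v))

/-- The first `n` of `2n+1` variables: `t_1, …, t_n`. -/
def tVar {n : ℕ} (x : Fin (2 * n + 1) → ℂˣ) (i : Fin n) : ℂˣ :=
  x ⟨i, by omega⟩

/-- The next `n` of `2n+1` variables: `u_1, …, u_n`. -/
def uVar {n : ℕ} (x : Fin (2 * n + 1) → ℂˣ) (j : Fin n) : ℂˣ :=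
  x ⟨n + j, by omega⟩

/-- The last of `2n+1` variables: `v`. -/
def vVar {n : ℕ} (x : Fin (2 * n + 1) → ℂˣ) : ℂˣ :=
  x (Fin.last (2 * n))

/-- The defining quotient of `Ψ_n (t_1, …, t_n, u_1, …, u_n, v)`, for functions `φ_1, φ_2, φ_3`
with alternant `Ψ_1`. It is meaningful where its denominators do not vanish. -/
def psiQuotient (p : ℂˣ) (n : ℕ) (φ : Fin 3 → ℂˣ → ℂ) (x : Fin (2 * n + 1) → ℂˣ) : ℂ :=
  (∏ i : Fin n, ∏ j : Fin n, cauchyDenom p (tVar x i) (uVar x j)) /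
      trivialFactor p (vVar x) ^ (n - 1) *
    (Matrix.of fun i j : Fin n =>
      alternant φ ![tVar x i, uVar x j, vVar x] / cauchyDenom p (tVar x i) (uVar x j)).det

/-- The set of points where all denominators in `psiQuotient` are nonzero. -/
def psiRegular (p : ℂˣ) (n : ℕ) : Set (Fin (2 * n + 1) → ℂˣ) :=
  {x | (∀ i j : Fin n, cauchyDenom p (tVar x i) (uVar x j) ≠ 0) ∧
    trivialFactor p (vVar x) ^ (n - 1) ≠ 0}

/-- The function `Ψ_n` on `(ℂˣ)^(2n+1)`: its defining quotient, extended by continuity (that is,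
by taking limits from `psiRegular p n`) across the removable zeros of the denominators. -/
def bigPsi (p : ℂˣ) (n : ℕ) (φ : Fin 3 → ℂˣ → ℂ) : (Fin (2 * n + 1) → ℂˣ) → ℂ :=
  extendFrom (psiRegular p n) (psiQuotient p n φ)

end

/-!
The numerator `N(t, u, v)` of `Ψ_n`, with the denominators of the determinant cleared
(`psiNumerator`), is compared with the alternant `D(t, u, v)` of a basis of `V_n`; the claim is that
`N = C · θ(v, ±pv; p²)^(n-1) · D` for a constant `C`. On the dense set where the denominators are
nonzero this says `Ψ_n = C · D`, and continuity of `D` gives the extension and the antisymmetry.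

In each of the variables `t_i` and `u_j` the numerator belongs to `V_n`, since multiplication by
`u⁻³ θ(u³ t^{±3}; p⁶)` maps `V_k` to `V_{k+1}`, and it vanishes when any two of the `2n + 1`
variables coincide. An element of `V_n` is determined by its values at `2n + 1` points where
`D ≠ 0`, so `N / D` does not change when one `t_i` or `u_j` is changed. As the ring of holomorphic
functions on the punctured plane is an integral domain, any two points with the same `v` can be
connected by such changes, and `N / D` depends only on `v` (`mul_alternant_eq_mul_alternant`). In
particular it is not necessary to know in advance that `Ψ_n` belongs to `V_n` as a function of `v`.

To find `N / D` as a function of `v`, put `t_i = ω u_i` (`cubicPoint`). The matrix in the numerator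
becomes diagonal, and `N` becomes a constant times `∏ Ψ_1(ω u_i, u_i, v)`. By the three-term
relation, an element of `V_n` that vanishes at `u_i` and `ω u_i` also vanishes at `ω² u_i`. For
generic `u_1, …, u_n` all zeros of `P(v) = θ(v, ±pv; p²) ∏ u_i⁻³ θ(u_i³ v^{±3}; p⁶)` are then
zeros of any `f ∈ V_n` that vanishes at all `u_i` and `ω u_i`. These zeros of `P` are simple, and
`f / P` is invariant under `v ↦ p² v`, so `f / P` is constant by Liouville's theorem
(`IsGeneric.exists_eq_const_mul`). This applies to each `Ψ_1(ω u_i, u_i, v)` with `n = 1` and to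
`D(ω u, u, v)`, and it also shows that the latter is not identically zero. Hence
`N / D` is a constant multiple of `θ(v, ±pv; p²)^(n-1)` (`exists_psiNumeratorVar_eq`).
-/

noncomputable section

open Function

/-! ### The theta function -/

/-- The infinite `q`-shifted factorial `(x; q)_∞ = ∏_{j ≥ 0} (1 - q ^ j x)`. -/
def qFactorial (q x : ℂ) : ℂ := ∏' j : ℕ, (1 - q ^ j * x)

section
variable {q : ℂ}

lemma summable_norm_neg_pow_mul (hq : ‖q‖ < 1) (x : ℂ) : Summable fun j : ℕ => ‖-(q ^ j * x)‖ := by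
  simpa using (summable_geometric_of_lt_one (norm_nonneg _) hq).mul_right ‖x‖

lemma multipliable_one_sub_pow_mul (hq : ‖q‖ < 1) (x : ℂ) :
    Multipliable fun j : ℕ => 1 - q ^ j * x := by
  simpa [sub_eq_add_neg] using multipliable_one_add_of_summable (summable_norm_neg_pow_mul hq x)

lemma qFactorial_eq_mul (hq : ‖q‖ < 1) (x : ℂ) :
    qFactorial q x = (1 - x) * qFactorial q (q * x) := by
  have e : ∀ j : ℕ, 1 - q ^ (j + 1) * x = 1 - q ^ j * (q * x) := fun j => by ring
  have h : Multipliable fun j : ℕ => 1 - q ^ (j + 1) * x := by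
    simp_rw [e]
    exact multipliable_one_sub_pow_mul hq (q * x)
  have h' : qFactorial q x = (1 - q ^ 0 * x) * ∏' j : ℕ, (1 - q ^ (j + 1) * x) :=
    tprod_eq_zero_mul' h
  rw [h', pow_zero, one_mul, qFactorial]
  exact congrArg _ (tprod_congr e)

lemma qFactorial_eq_zero_iff (hq : ‖q‖ < 1) {x : ℂ} :
    qFactorial q x = 0 ↔ ∃ j : ℕ, q ^ j * x = 1 := by
  constructor
  · intro h
    by_contra! hx
    refine tprod_one_add_ne_zero_of_summable (f := fun j : ℕ => -(q ^ j * x)) (fun j => ?_)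
      (summable_norm_neg_pow_mul hq x) ?_
    · rw [← sub_eq_add_neg, sub_ne_zero]
      exact (hx j).symm
    · simpa [qFactorial, sub_eq_add_neg] using h
  · rintro ⟨j, hj⟩
    exact tprod_of_exists_eq_zero ⟨j, by simp [hj]⟩

lemma differentiable_qFactorial (hq : ‖q‖ < 1) : Differentiable ℂ (qFactorial q) := by
  intro x
  have hu : Summable fun j : ℕ => ‖q‖ ^ j * (‖x‖ + 1) :=
    (summable_geometric_of_lt_one (norm_nonneg _) hq).mul_right _
  have h := Summable.hasProdLocallyUniformlyOn_nat_one_add (f := fun (j : ℕ) (z : ℂ) => -(q ^ j * z))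
    (K := Metric.ball (0 : ℂ) (‖x‖ + 1)) Metric.isOpen_ball hu
    (.of_forall fun j z hz => by
      rw [norm_neg, norm_mul, norm_pow]
      gcongr
      exact (mem_ball_zero_iff.mp hz).le) (fun j => by fun_prop)
  have h' := h.differentiableOn (.of_forall fun s => by
    simpa [Finset.prod_fn] using DifferentiableOn.finsetProd (fun _ _ => by fun_prop))
    Metric.isOpen_ball
  have hx : Metric.ball (0 : ℂ) (‖x‖ + 1) ∈ nhds x :=
    Metric.isOpen_ball.mem_nhds (by simp)
  rw [show qFactorial q = fun z => ∏' j : ℕ, (1 + -(q ^ j * z)) from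
    funext fun z => by simp only [qFactorial, sub_eq_add_neg]]
  exact h'.differentiableAt hx

lemma ellTheta_eq_mul (hq : ‖q‖ < 1) (x : ℂ) :
    ellTheta q x = qFactorial q x * qFactorial q (q / x) := by
  rw [qFactorial, qFactorial, ← (multipliable_one_sub_pow_mul hq x).tprod_mul
    (multipliable_one_sub_pow_mul hq (q / x)), ellTheta]
  simp [pow_succ, mul_div_assoc]

lemma ellTheta_eq_one_sub_mul (hq : ‖q‖ < 1) (x : ℂ) :
    ellTheta q x = (1 - x) * (qFactorial q (q * x) * qFactorial q (q / x)) := by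
  rw [ellTheta_eq_mul hq, qFactorial_eq_mul hq, mul_assoc]

lemma ellTheta_mul (hq : ‖q‖ < 1) (hq0 : q ≠ 0) {x : ℂ} (hx : x ≠ 0) :
    ellTheta q (q * x) = -x⁻¹ * ellTheta q x := by
  rw [ellTheta_eq_one_sub_mul hq x, ellTheta_eq_mul hq, qFactorial_eq_mul hq (q / (q * x)),
    show q / (q * x) = x⁻¹ by field_simp, ← div_eq_mul_inv q x]
  field_simp
  ring

lemma ellTheta_inv (hq : ‖q‖ < 1) {x : ℂ} (hx : x ≠ 0) :
    ellTheta q x⁻¹ = -x⁻¹ * ellTheta q x := by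
  rw [ellTheta_eq_one_sub_mul hq, ellTheta_eq_one_sub_mul hq, div_inv_eq_mul, ← div_eq_mul_inv]
  field_simp
  ring

lemma ellTheta_one : ellTheta q 1 = 0 :=
  tprod_of_exists_eq_zero ⟨0, by simp⟩

lemma ellTheta_eq_zero_iff (hq : ‖q‖ < 1) (hq0 : q ≠ 0) {x : ℂ} (hx : x ≠ 0) :
    ellTheta q x = 0 ↔ ∃ k : ℤ, x = q ^ k := by
  constructor
  · rw [ellTheta_eq_mul hq, mul_eq_zero, qFactorial_eq_zero_iff hq, qFactorial_eq_zero_iff hq]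
    rintro (⟨j, hj⟩ | ⟨j, hj⟩)
    · refine ⟨-j, ?_⟩
      rw [zpow_neg, zpow_natCast]
      exact eq_inv_of_mul_eq_one_right hj
    · refine ⟨j + 1, ?_⟩
      rw [zpow_add_one₀ hq0, zpow_natCast]
      field_simp at hj
      exact hj.symm
  · rintro ⟨k, rfl⟩
    induction k using Int.induction_on with
    | zero => simpa using ellTheta_one
    | succ k ih =>
      rw [zpow_add_one₀ hq0, mul_comm, ellTheta_mul hq hq0 (zpow_ne_zero _ hq0),
        ih (zpow_ne_zero _ hq0), mul_zero]
    | pred k ih =>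
      have h := ellTheta_mul hq hq0 (zpow_ne_zero (-(k : ℤ) - 1) hq0)
      rw [← zpow_one_add₀ hq0, add_sub_cancel, ih (zpow_ne_zero _ hq0)] at h
      exact (mul_eq_zero.mp h.symm).resolve_left
        (neg_ne_zero.mpr (inv_ne_zero (zpow_ne_zero _ hq0)))

lemma differentiableAt_ellTheta (hq : ‖q‖ < 1) {x : ℂ} (hx : x ≠ 0) :
    DifferentiableAt ℂ (ellTheta q) x := by
  rw [show ellTheta q = fun x => qFactorial q x * qFactorial q (q / x) from
    funext (ellTheta_eq_mul hq)]
  have := differentiable_qFactorial hq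
  exact (this x).mul ((this (q / x)).comp x ((differentiableAt_const q).div differentiableAt_id hx))

lemma deriv_ellTheta_one_ne_zero (hq : ‖q‖ < 1) : deriv (ellTheta q) 1 ≠ 0 := by
  set K : ℂ → ℂ := fun x => qFactorial q (q * x) * qFactorial q (q / x) with hK
  have hd : DifferentiableAt ℂ K 1 := by
    have := differentiable_qFactorial hq
    exact ((this _).comp (1 : ℂ) (differentiableAt_id.const_mul q)).mul
      ((this _).comp (1 : ℂ) ((differentiableAt_const q).div differentiableAt_id one_ne_zero))
  have h := (((hasDerivAt_id (1 : ℂ)).const_sub 1).mul hd.hasDerivAt).deriv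
  have hne : qFactorial q q ≠ 0 := by
    rw [Ne, qFactorial_eq_zero_iff hq]
    rintro ⟨j, hj⟩
    rw [← pow_succ] at hj
    have := pow_lt_one₀ (norm_nonneg q) hq (Nat.succ_ne_zero j)
    rw [← norm_pow, hj, norm_one] at this
    exact lt_irrefl _ this
  rw [show ellTheta q = (fun x => 1 - id x) * K from
    funext fun x => by simp [hK, ellTheta_eq_one_sub_mul hq x], h]
  simp [hK, hne]

/-- All zeros of the theta function are simple: the zero `1` is, and the quasi-periodicity carries
this to the other zeros `q ^ k`. -/
lemma deriv_ellTheta_ne_zero (hq : ‖q‖ < 1) (hq0 : q ≠ 0) {x : ℂ} (hx : x ≠ 0)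
    (h0 : ellTheta q x = 0) : deriv (ellTheta q) x ≠ 0 := by
  have key : ∀ y : ℂ, y ≠ 0 → ellTheta q y = 0 →
      q * deriv (ellTheta q) (q * y) = -y⁻¹ * deriv (ellTheta q) y := by
    intro y hy hy0
    have h1 : HasDerivAt (fun z => ellTheta q (q * z)) (deriv (ellTheta q) (q * y) * (q * 1)) y :=
      (differentiableAt_ellTheta hq (mul_ne_zero hq0 hy)).hasDerivAt.comp y
        ((hasDerivAt_id y).const_mul q)
    have h2 := ((hasDerivAt_inv hy).neg).mul (differentiableAt_ellTheta hq hy).hasDerivAt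
    have h3 := h2.congr_of_eventuallyEq (f₁ := fun z => ellTheta q (q * z)) (by
      filter_upwards [isOpen_ne.mem_nhds hy] with z hz
      simp [ellTheta_mul hq hq0 hz])
    have h4 := h1.unique h3
    rw [hy0, mul_zero, zero_add] at h4
    calc q * deriv (ellTheta q) (q * y) = deriv (ellTheta q) (q * y) * (q * 1) := by ring
      _ = _ := h4
  obtain ⟨k, rfl⟩ := (ellTheta_eq_zero_iff hq hq0 hx).mp h0
  clear h0
  have hz : ∀ k : ℤ, ellTheta q (q ^ k) = 0 := fun k =>
    (ellTheta_eq_zero_iff hq hq0 (zpow_ne_zero _ hq0)).mpr ⟨k, rfl⟩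
  induction k using Int.induction_on with
  | zero => simpa using deriv_ellTheta_one_ne_zero hq
  | succ k ih =>
    intro h
    have := key _ (zpow_ne_zero k hq0) (hz k)
    rw [← zpow_one_add₀ hq0, add_comm, h, mul_zero] at this
    exact mul_ne_zero (neg_ne_zero.mpr (inv_ne_zero (zpow_ne_zero _ hq0)))
      (ih (zpow_ne_zero _ hq0)) this.symm
  | pred k ih =>
    intro h
    have := key _ (zpow_ne_zero (-(k : ℤ) - 1) hq0) (hz _)
    rw [← zpow_one_add₀ hq0, add_sub_cancel, h, mul_zero] at this
    exact mul_ne_zero hq0 (ih (zpow_ne_zero _ hq0)) this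

end

/-! ### Holomorphic functions on the punctured plane -/

namespace HolomorphicOnUnits

open Topology

variable {f g : ℂˣ → ℂ}

lemma const (c : ℂ) : HolomorphicOnUnits fun _ => c :=
  ⟨fun _ => c, differentiableOn_const c, fun _ => rfl⟩

lemma add (hf : HolomorphicOnUnits f) (hg : HolomorphicOnUnits g) :
    HolomorphicOnUnits fun z => f z + g z := by
  obtain ⟨F, hF, hFf⟩ := hf
  obtain ⟨G, hG, hGg⟩ := hg
  exact ⟨fun z => F z + G z, hF.add hG, fun z => by simp only [hFf, hGg]⟩

lemma sub (hf : HolomorphicOnUnits f) (hg : HolomorphicOnUnits g) :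
    HolomorphicOnUnits fun z => f z - g z := by
  obtain ⟨F, hF, hFf⟩ := hf
  obtain ⟨G, hG, hGg⟩ := hg
  exact ⟨fun z => F z - G z, hF.sub hG, fun z => by simp only [hFf, hGg]⟩

lemma mul (hf : HolomorphicOnUnits f) (hg : HolomorphicOnUnits g) :
    HolomorphicOnUnits fun z => f z * g z := by
  obtain ⟨F, hF, hFf⟩ := hf
  obtain ⟨G, hG, hGg⟩ := hg
  exact ⟨fun z => F z * G z, hF.mul hG, fun z => by simp only [hFf, hGg]⟩

lemma sum {ι : Type*} (s : Finset ι) {f : ι → ℂˣ → ℂ} (hf : ∀ i ∈ s, HolomorphicOnUnits (f i)) :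
    HolomorphicOnUnits fun z => ∑ i ∈ s, f i z := by
  classical
  induction s using Finset.induction_on with
  | empty => simpa using const 0
  | insert a s ha ih =>
    simp only [Finset.sum_insert ha]
    exact (hf a (Finset.mem_insert_self a s)).add
      (ih fun i hi => hf i (Finset.mem_insert_of_mem hi))

lemma prod {ι : Type*} (s : Finset ι) {f : ι → ℂˣ → ℂ} (hf : ∀ i ∈ s, HolomorphicOnUnits (f i)) :
    HolomorphicOnUnits fun z => ∏ i ∈ s, f i z := by
  classical
  induction s using Finset.induction_on with
  | empty => simpa using const 1
  | insert a s ha ih =>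
    simp only [Finset.prod_insert ha]
    exact (hf a (Finset.mem_insert_self a s)).mul
      (ih fun i hi => hf i (Finset.mem_insert_of_mem hi))

lemma pow (hf : HolomorphicOnUnits f) (k : ℕ) : HolomorphicOnUnits fun z => f z ^ k := by
  simpa using prod (Finset.range k) fun _ _ => hf

lemma det {ι : Type*} [Fintype ι] [DecidableEq ι] {A : ℂˣ → Matrix ι ι ℂ}
    (hA : ∀ i j, HolomorphicOnUnits fun z => A z i j) : HolomorphicOnUnits fun z => (A z).det := by
  simp only [Matrix.det_apply']
  exact sum _ fun σ _ => (const _).mul (prod _ fun i _ => hA _ _)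

lemma inv_coe_pow (k : ℕ) : HolomorphicOnUnits fun z => ((z : ℂ) ^ k)⁻¹ :=
  ⟨fun z => (z ^ k)⁻¹, fun _ hz => ((differentiableAt_id.pow k).inv
    (pow_ne_zero k hz)).differentiableWithinAt, fun _ => rfl⟩

lemma comp_mul_left (hf : HolomorphicOnUnits f) (a : ℂˣ) :
    HolomorphicOnUnits fun z => f (a * z) := by
  obtain ⟨F, hF, hFf⟩ := hf
  refine ⟨fun z => F (a * z), hF.comp (by fun_prop) fun z hz => mul_ne_zero a.ne_zero hz,
    fun z => ?_⟩
  simp only [← hFf, Units.val_mul]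

protected lemma continuous (hf : HolomorphicOnUnits f) : Continuous f := by
  obtain ⟨F, hF, hFf⟩ := hf
  rw [show f = F ∘ Units.val from funext fun z => (hFf z).symm]
  exact hF.continuousOn.comp_continuous Units.continuous_val fun z => z.ne_zero

/-- The identity theorem on the punctured plane. -/
lemma dense_ne_zero (hf : HolomorphicOnUnits f) {x : ℂˣ} (hx : f x ≠ 0) :
    Dense {z | f z ≠ 0} := by
  obtain ⟨F, hF, hFf⟩ := hf
  by_contra hd
  have hne : (interior {z | f z = 0}).Nonempty := by
    rw [← Set.compl_ofPred, ← interior_eq_empty_iff_dense_compl] at hd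
    exact Set.nonempty_iff_ne_empty.mpr hd
  obtain ⟨z, hz⟩ := hne
  have hev : ∀ᶠ w in 𝓝 (z : ℂ), F w = 0 := by
    rw [← Units.isOpenEmbedding_val.map_nhds_eq, Filter.eventually_map]
    filter_upwards [mem_interior_iff_mem_nhds.mp hz] with w hw
    rw [hFf]
    exact hw
  have h := (hF.analyticOnNhd isOpen_compl_singleton).eqOn_zero_of_preconnected_of_eventuallyEq_zero
    (isConnected_compl_singleton_of_one_lt_rank (by simp) 0).isPreconnected z.ne_zero hev
  exact hx (by rw [← hFf]; exact h x.ne_zero)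

/-- The ring of holomorphic functions on the punctured plane has no zero divisors: two functions
that do not vanish identically are nonzero at a common point. -/
lemma exists_ne_zero_and_ne_zero (hf : HolomorphicOnUnits f) (hg : HolomorphicOnUnits g) {x y : ℂˣ}
    (hx : f x ≠ 0) (hy : g y ≠ 0) : ∃ z, f z ≠ 0 ∧ g z ≠ 0 := by
  obtain ⟨z, hz, hz'⟩ := (hf.dense_ne_zero hx).inter_open_nonempty _
    (isOpen_ne_fun hg.continuous continuous_const) ⟨y, hy⟩
  exact ⟨z, hz', hz⟩

/-- A holomorphic function on the punctured plane that is invariant under multiplication by `q`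
is constant. -/
lemma eq_const_of_periodic (hf : HolomorphicOnUnits f) {q : ℂˣ} (hq : ‖(q : ℂ)‖ < 1)
    (hper : ∀ x, f (q * x) = f x) (x y : ℂˣ) : f x = f y := by
  have hzpow : ∀ (k : ℤ) x, f (q ^ k * x) = f x := by
    intro k
    induction k using Int.induction_on with
    | zero => simp
    | succ k ih => intro x; rw [zpow_add_one, mul_assoc, ih, hper]
    | pred k ih =>
      intro x
      rw [zpow_sub_one, mul_assoc, ih, ← hper (q⁻¹ * x), mul_inv_cancel_left]
  obtain ⟨F, hF, hFf⟩ := hf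
  have hq0 : 0 < ‖(q : ℂ)‖ := norm_pos_iff.mpr q.ne_zero
  have hcpt : IsCompact (Metric.closedBall (0 : ℂ) ‖(q : ℂ)‖⁻¹ \ Metric.ball 0 1) :=
    (isCompact_closedBall _ _).diff Metric.isOpen_ball
  obtain ⟨M, hM⟩ := hcpt.exists_bound_of_continuousOn (hF.continuousOn.mono fun z hz h0 => by
    simp only [Set.mem_singleton_iff] at h0
    simp [h0] at hz)
  have hbound : ∀ x : ℂˣ, ‖F x‖ ≤ M := by
    intro x
    obtain ⟨k, hk1, hk2⟩ := exists_mem_Ico_zpow (norm_pos_iff.mpr x.ne_zero)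
      ((one_lt_inv₀ hq0).mpr hq)
    rw [hFf, ← hzpow k, ← hFf]
    have hpos : 0 < ‖(q : ℂ)‖ ^ k := zpow_pos hq0 k
    rw [inv_zpow, inv_le_iff_one_le_mul₀' hpos] at hk1
    rw [zpow_add_one₀ (inv_ne_zero hq0.ne'), inv_zpow, lt_inv_mul_iff₀ hpos] at hk2
    refine hM _ ⟨?_, ?_⟩
    · simpa using hk2.le
    · simpa using hk1
  have hent : Differentiable ℂ fun z => F (Complex.exp z) := fun z =>
    (hF.differentiableAt (isOpen_compl_singleton.mem_nhds (Complex.exp_ne_zero z))).comp z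
      Complex.differentiable_exp.differentiableAt
  have hbdd : Bornology.IsBounded (Set.range fun z => F (Complex.exp z)) := by
    refine isBounded_iff_forall_norm_le.mpr ⟨M, ?_⟩
    rintro _ ⟨z, rfl⟩
    exact hbound (Units.mk0 _ (Complex.exp_ne_zero z))
  have h := hent.apply_eq_apply_of_bounded hbdd (Complex.log x) (Complex.log y)
  rwa [Complex.exp_log x.ne_zero, Complex.exp_log y.ne_zero, hFf, hFf] at h

end HolomorphicOnUnits

/-- A function `P` on the punctured plane whose zeros are all simple, encoded as divisibility: `P`
divides every holomorphic function that vanishes at its zeros. -/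
def HasSimpleZeros (P : ℂˣ → ℂ) : Prop :=
  ∀ f : ℂˣ → ℂ, HolomorphicOnUnits f → (∀ z, P z = 0 → f z = 0) →
    ∃ g : ℂˣ → ℂ, HolomorphicOnUnits g ∧ ∀ z, f z = g z * P z

namespace HasSimpleZeros

open Topology

lemma of_deriv_ne_zero {P : ℂ → ℂ} (hP : DifferentiableOn ℂ P {0}ᶜ)
    (h : ∀ z, z ≠ 0 → P z = 0 → deriv P z ≠ 0) : HasSimpleZeros fun z => P z := by
  rintro f ⟨F, hF, hFf⟩ hz
  have hz' : ∀ z, z ≠ 0 → P z = 0 → F z = 0 := fun z h0 hPz =>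
    (hFf (Units.mk0 z h0)).trans (hz (Units.mk0 z h0) hPz)
  have hnhds : ∀ z : ℂ, z ≠ 0 → ({0}ᶜ : Set ℂ) ∈ 𝓝 z := fun z => isOpen_compl_singleton.mem_nhds
  classical
  -- at a zero of `P` the quotient `F / P` takes the value `F' / P'`
  refine ⟨fun z => if P z = 0 then deriv F z / deriv P z else F z / P z,
    ⟨fun z => if P z = 0 then deriv F z / deriv P z else F z / P z, ?_, fun _ => rfl⟩, ?_⟩
  · intro z hz0
    refine DifferentiableAt.differentiableWithinAt ?_
    have hPz := hP.differentiableAt (hnhds z hz0)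
    have hFz := hF.differentiableAt (hnhds z hz0)
    by_cases hzero : P z = 0
    · have hdF := ((Complex.differentiableOn_dslope (hnhds z hz0)).mpr hF).differentiableAt
        (hnhds z hz0)
      have hdP := ((Complex.differentiableOn_dslope (hnhds z hz0)).mpr hP).differentiableAt
        (hnhds z hz0)
      have hne : dslope P z z ≠ 0 := by
        rw [dslope_same]
        exact h z hz0 hzero
      refine (hdF.div hdP hne).congr_of_eventuallyEq ?_
      filter_upwards [hdP.continuousAt.eventually_ne hne] with w hw
      by_cases hwz : w = z
      · simp [hwz, hzero]
      · have hwz' : w - z ≠ 0 := sub_ne_zero.mpr hwz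
        rw [dslope_of_ne _ hwz, slope_def_field, hzero, sub_zero] at hw
        have hPw : P w ≠ 0 := fun h0 => hw (by rw [h0, zero_div])
        rw [if_neg hPw, Pi.div_apply, dslope_of_ne _ hwz, dslope_of_ne _ hwz, slope_def_field,
          slope_def_field, hzero, hz' z hz0 hzero, sub_zero, sub_zero,
          div_div_div_cancel_right₀ hwz']
    · refine (hFz.div hPz hzero).congr_of_eventuallyEq ?_
      filter_upwards [hPz.continuousAt.eventually_ne hzero] with w hw
      simp [hw]
  · intro z
    by_cases hzero : P z = 0
    · simp [hzero, hz z hzero]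
    · simp [hzero, hFf]

lemma mul {P Q : ℂˣ → ℂ} (hP : HasSimpleZeros P) (hQ : HasSimpleZeros Q)
    (hPQ : ∀ z, P z = 0 → Q z ≠ 0) : HasSimpleZeros fun z => P z * Q z := by
  intro f hf hz
  obtain ⟨g, hg, hfg⟩ := hP f hf fun z h => hz z (by simp [h])
  obtain ⟨k, hk, hgk⟩ := hQ g hg fun z h => by
    have := hfg z
    rw [hz z (by simp [h])] at this
    exact (mul_eq_zero.mp this.symm).resolve_right fun h' => hPQ z h' h
  exact ⟨k, hk, fun z => by rw [hfg, hgk]; ring⟩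

lemma inv_coe_pow (k : ℕ) : HasSimpleZeros fun z => ((z : ℂ) ^ k)⁻¹ :=
  fun f hf _ => ⟨fun z => f z * (z : ℂ) ^ k, hf.mul (HolomorphicOnUnits.pow
    ⟨id, differentiableOn_id, fun _ => rfl⟩ k), fun z => by simp⟩

lemma prod {ι : Type*} (s : Finset ι) {P : ι → ℂˣ → ℂ} (hP : ∀ i ∈ s, HasSimpleZeros (P i))
    (hPP : ∀ i ∈ s, ∀ j ∈ s, i ≠ j → ∀ z, P i z = 0 → P j z ≠ 0) :
    HasSimpleZeros fun z => ∏ i ∈ s, P i z := by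
  classical
  induction s using Finset.induction_on with
  | empty => simpa using inv_coe_pow 0
  | insert a s ha ih =>
    simp only [Finset.prod_insert ha]
    refine (hP a (Finset.mem_insert_self a s)).mul
      (ih (fun i hi => hP i (Finset.mem_insert_of_mem hi)) fun i hi j hj =>
        hPP i (Finset.mem_insert_of_mem hi) j (Finset.mem_insert_of_mem hj)) fun z hz => ?_
    exact Finset.prod_ne_zero_iff.mpr fun j hj => hPP a (Finset.mem_insert_self a s) j
      (Finset.mem_insert_of_mem hj) (fun h => ha (h ▸ hj)) z hz

end HasSimpleZeros

section

variable {q c : ℂ}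

lemma differentiableOn_ellTheta_mul_pow (hq : ‖q‖ < 1) (hc : c ≠ 0) (k : ℕ) :
    DifferentiableOn ℂ (fun z => ellTheta q (c * z ^ k)) {0}ᶜ := by
  intro z hz
  have h : DifferentiableAt ℂ (fun z => c * z ^ k) z := by fun_prop
  have h' : DifferentiableAt ℂ (ellTheta q) (c * z ^ k) :=
    differentiableAt_ellTheta hq (mul_ne_zero hc (pow_ne_zero k hz))
  exact (h'.comp z h).differentiableWithinAt

lemma holomorphicOnUnits_ellTheta_mul_pow (hq : ‖q‖ < 1) (hc : c ≠ 0) (k : ℕ) :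
    HolomorphicOnUnits fun z => ellTheta q (c * (z : ℂ) ^ k) :=
  ⟨_, differentiableOn_ellTheta_mul_pow hq hc k, fun _ => rfl⟩

lemma hasSimpleZeros_ellTheta_mul_pow (hq : ‖q‖ < 1) (hq0 : q ≠ 0) (hc : c ≠ 0) {k : ℕ}
    (hk : k ≠ 0) :
    HasSimpleZeros fun z => ellTheta q (c * (z : ℂ) ^ k) := by
  refine HasSimpleZeros.of_deriv_ne_zero (differentiableOn_ellTheta_mul_pow hq hc k)
    fun z hz h0 => ?_
  have hne := mul_ne_zero hc (pow_ne_zero k hz)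
  have h := (differentiableAt_ellTheta hq hne).hasDerivAt.comp z
    ((hasDerivAt_pow k z).const_mul c)
  rw [show (fun z => ellTheta q (c * z ^ k)) = ellTheta q ∘ fun z => c * z ^ k from rfl, h.deriv]
  exact mul_ne_zero (deriv_ellTheta_ne_zero hq hq0 hne h0)
    (mul_ne_zero hc (mul_ne_zero (Nat.cast_ne_zero.mpr hk) (pow_ne_zero _ hz)))

end

/-! ### The factors `u⁻³ θ(u³ t³, u³ t⁻³; p⁶)` -/

lemma cubicRoot_pow_three : cubicRoot ^ 3 = 1 := by
  ext
  rw [Units.val_pow_eq_pow_val, Units.val_one]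
  simpa [cubicRoot] using (Complex.isPrimitiveRoot_exp 3 (by norm_num)).pow_eq_one

lemma coe_cubicRoot_pow_three : (cubicRoot : ℂ) ^ 3 = 1 := by
  rw [← Units.val_pow_eq_pow_val, cubicRoot_pow_three, Units.val_one]

lemma exists_eq_cubicRoot_pow_mul {x y : ℂˣ} (h : x ^ 3 = y ^ 3) :
    ∃ l < 3, x = cubicRoot ^ l * y := by
  have h1 : ((x / y : ℂˣ) : ℂ) ^ 3 = 1 := by
    rw [← Units.val_pow_eq_pow_val, div_pow, h, div_self', Units.val_one]
  have hprim : IsPrimitiveRoot (cubicRoot : ℂ) 3 := by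
    simpa [cubicRoot] using Complex.isPrimitiveRoot_exp 3 (by norm_num)
  obtain ⟨l, hl, hl'⟩ := hprim.eq_pow_of_pow_eq_one h1
  refine ⟨l, hl, ?_⟩
  rw [← Units.val_pow_eq_pow_val, Units.val_inj] at hl'
  rw [hl', div_mul_cancel]

section

variable {p : ℂˣ}

lemma norm_pow_lt_one (hp : ‖(p : ℂ)‖ < 1) {k : ℕ} (hk : k ≠ 0) : ‖(p : ℂ) ^ k‖ < 1 := by
  rw [norm_pow]
  exact pow_lt_one₀ (norm_nonneg _) hp hk

lemma cauchyDenom_swap (hp : ‖(p : ℂ)‖ < 1) (t u : ℂˣ) :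
    cauchyDenom p t u = -cauchyDenom p u t := by
  have ht := t.ne_zero
  have hu := u.ne_zero
  have h := ellTheta_inv (norm_pow_lt_one hp (k := 6) (by norm_num))
    (x := (t : ℂ) ^ 3 * ((u : ℂ) ^ 3)⁻¹) (by positivity)
  rw [mul_inv, inv_inv, mul_comm] at h
  rw [cauchyDenom, cauchyDenom, h, mul_comm ((u : ℂ) ^ 3) ((t : ℂ) ^ 3)]
  field_simp

lemma cauchyDenom_inv (hp : ‖(p : ℂ)‖ < 1) (t u : ℂˣ) :
    cauchyDenom p t u⁻¹ = cauchyDenom p t u := by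
  have ht := t.ne_zero
  have hu := u.ne_zero
  have hp6 := norm_pow_lt_one hp (k := 6) (by norm_num)
  have h1 := ellTheta_inv hp6 (x := (u : ℂ) ^ 3 * (t : ℂ) ^ 3) (by positivity)
  have h2 := ellTheta_inv hp6 (x := (u : ℂ) ^ 3 * ((t : ℂ) ^ 3)⁻¹) (by positivity)
  rw [mul_inv] at h1 h2
  rw [inv_inv] at h2
  rw [cauchyDenom, cauchyDenom, Units.val_inv_eq_inv_val, inv_pow, h1, h2]
  field_simp

lemma cauchyDenom_cubicRoot_pow_mul (k : ℕ) (t u : ℂˣ) :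
    cauchyDenom p t (cubicRoot ^ k * u) = cauchyDenom p t u := by
  have h : ((cubicRoot ^ k * u : ℂˣ) : ℂ) ^ 3 = (u : ℂ) ^ 3 := by
    rw [Units.val_mul, mul_pow, Units.val_pow_eq_pow_val, ← pow_mul, mul_comm k, pow_mul,
      coe_cubicRoot_pow_three, one_pow, one_mul]
  rw [cauchyDenom, cauchyDenom, h]

lemma cauchyDenom_self (t : ℂˣ) : cauchyDenom p t t = 0 := by
  rw [cauchyDenom, mul_inv_cancel₀ (pow_ne_zero 3 t.ne_zero), ellTheta_one, mul_zero, mul_zero]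

lemma cauchyDenom_cubicRoot_mul_self (t : ℂˣ) : cauchyDenom p (cubicRoot * t) t = 0 := by
  have h := cauchyDenom_cubicRoot_pow_mul (p := p) 1 (cubicRoot * t) t
  rw [pow_one, cauchyDenom_self] at h
  exact h.symm

lemma cauchyDenom_mul (hp : ‖(p : ℂ)‖ < 1) (t u : ℂˣ) :
    cauchyDenom p t (p ^ 2 * u) = ((p : ℂ) ^ 6 * (u : ℂ) ^ 6)⁻¹ * cauchyDenom p t u := by
  have ht := t.ne_zero
  have hu := u.ne_zero
  have hp0 := p.ne_zero
  have hp6 := norm_pow_lt_one hp (k := 6) (by norm_num)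
  have h1 := ellTheta_mul hp6 (by positivity) (x := (u : ℂ) ^ 3 * (t : ℂ) ^ 3) (by positivity)
  have h2 := ellTheta_mul hp6 (by positivity) (x := (u : ℂ) ^ 3 * ((t : ℂ) ^ 3)⁻¹) (by positivity)
  have e : ((p ^ 2 * u : ℂˣ) : ℂ) ^ 3 = (p : ℂ) ^ 6 * (u : ℂ) ^ 3 := by
    push_cast; ring
  rw [cauchyDenom, cauchyDenom, e, mul_assoc, h1, mul_assoc ((p : ℂ) ^ 6), h2]
  field_simp

lemma holomorphicOnUnits_cauchyDenom (hp : ‖(p : ℂ)‖ < 1) (t : ℂˣ) :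
    HolomorphicOnUnits (cauchyDenom p t) := by
  have hp6 := norm_pow_lt_one hp (k := 6) (by norm_num)
  have h := (HolomorphicOnUnits.inv_coe_pow 3).mul
    ((holomorphicOnUnits_ellTheta_mul_pow hp6 (pow_ne_zero 3 t.ne_zero) 3).mul
      (holomorphicOnUnits_ellTheta_mul_pow hp6 (inv_ne_zero (pow_ne_zero 3 t.ne_zero)) 3))
  simp only [mul_comm ((t : ℂ) ^ 3), mul_comm ((t : ℂ) ^ 3)⁻¹] at h
  exact h

lemma holomorphicOnUnits_cauchyDenom_left (hp : ‖(p : ℂ)‖ < 1) (u : ℂˣ) :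
    HolomorphicOnUnits fun t => cauchyDenom p t u := by
  have h := (HolomorphicOnUnits.const (-1)).mul (holomorphicOnUnits_cauchyDenom hp u)
  simpa only [neg_one_mul, ← cauchyDenom_swap hp] using h

lemma pow_three_eq_of_cauchyDenom_eq_zero (hp : ‖(p : ℂ)‖ < 1) {t u : ℂˣ}
    (h : cauchyDenom p t u = 0) :
    ∃ k : ℤ, u ^ 3 = ((p ^ 2) ^ k * t⁻¹) ^ 3 ∨ u ^ 3 = ((p ^ 2) ^ k * t) ^ 3 := by
  have ht := t.ne_zero
  have hu := u.ne_zero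
  have hp0 := p.ne_zero
  have hp6 := norm_pow_lt_one hp (k := 6) (by norm_num)
  have e : ∀ k : ℤ, ((p : ℂ) ^ 6) ^ k = (((p : ℂ) ^ 2) ^ k) ^ 3 := fun k => by
    rw [← zpow_natCast, ← zpow_natCast, ← zpow_natCast, ← zpow_mul, ← zpow_mul, ← zpow_mul]
    congr 1
    push_cast
    ring
  rw [cauchyDenom, mul_eq_zero, mul_eq_zero, or_iff_right (by positivity),
    ellTheta_eq_zero_iff hp6 (by positivity) (by positivity),
    ellTheta_eq_zero_iff hp6 (by positivity) (by positivity)] at h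
  rcases h with ⟨k, hk⟩ | ⟨k, hk⟩ <;> rw [e] at hk <;> refine ⟨k, ?_⟩
  · left
    ext
    push_cast
    rw [mul_pow, ← hk]
    field_simp
  · right
    ext
    push_cast
    rw [mul_pow, ← hk]
    field_simp

lemma log_norm_of_cauchyDenom_eq_zero (hp : ‖(p : ℂ)‖ < 1) {t u : ℂˣ}
    (h : cauchyDenom p t u = 0) :
    ∃ k : ℤ, Real.log ‖(u : ℂ)‖ = 2 * k * Real.log ‖(p : ℂ)‖ - Real.log ‖(t : ℂ)‖ ∨
      Real.log ‖(u : ℂ)‖ = 2 * k * Real.log ‖(p : ℂ)‖ + Real.log ‖(t : ℂ)‖ := by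
  have ht := norm_ne_zero_iff.mpr t.ne_zero
  have hp0 := norm_ne_zero_iff.mpr p.ne_zero
  obtain ⟨k, hk⟩ := pow_three_eq_of_cauchyDenom_eq_zero hp h
  refine ⟨k, hk.imp (fun h => ?_) (fun h => ?_)⟩ <;>
  · have h' := congrArg (fun x : ℂˣ => Real.log ‖(x : ℂ)‖) h
    simp only [Units.val_pow_eq_pow_val, Units.val_mul, Units.val_zpow_eq_zpow_val, norm_pow,
      norm_mul, norm_zpow, Units.val_inv_eq_inv_val, norm_inv, Real.log_pow] at h'
    rw [Real.log_mul (by positivity) (by positivity)] at h'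
    simp only [Real.log_zpow, Real.log_pow, Real.log_inv] at h'
    push_cast at h'
    linarith

/-! ### The spaces `V_n` -/

lemma mul_cauchyDenom_mem_thetaSpace (hp : ‖(p : ℂ)‖ < 1) {n : ℕ} {f : ℂˣ → ℂ}
    (hf : f ∈ thetaSpace p n) (t : ℂˣ) :
    (fun x => f x * cauchyDenom p t x) ∈ thetaSpace p (n + 1) := by
  obtain ⟨⟨hf1, hf2, hf3⟩, hf4⟩ := hf
  refine ⟨⟨hf1.mul (holomorphicOnUnits_cauchyDenom hp t), fun x => ?_, fun x => ?_⟩, fun x => ?_⟩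
  · have hx := x.ne_zero
    have hp0 := p.ne_zero
    rw [hf2, cauchyDenom_mul hp]
    push_cast
    field_simp
    ring
  · rw [hf3, cauchyDenom_inv hp, mul_assoc]
  · simp only [cauchyDenom_cubicRoot_pow_mul, ← mul_assoc]
    rw [← Finset.sum_mul, hf4, zero_mul]

lemma mul_prod_cauchyDenom_mem_thetaSpace (hp : ‖(p : ℂ)‖ < 1) {n : ℕ} {f : ℂˣ → ℂ}
    (hf : f ∈ thetaSpace p n) {ι : Type*} (s : Finset ι) (t : ι → ℂˣ) :
    (fun x => f x * ∏ i ∈ s, cauchyDenom p (t i) x) ∈ thetaSpace p (n + s.card) := by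
  classical
  induction s using Finset.induction_on with
  | empty => simpa using hf
  | insert a s ha ih =>
    rw [Finset.card_insert_of_notMem ha, ← add_assoc]
    convert mul_cauchyDenom_mem_thetaSpace hp ih (t a) using 2 with x
    rw [Finset.prod_insert ha]
    ring

section

variable {n : ℕ} {f : ℂˣ → ℂ} (hf : f ∈ thetaSpace p n)

include hf

lemma thetaSpace_apply_mul_eq_zero_iff (x : ℂˣ) : f (p ^ 2 * x) = 0 ↔ f x = 0 := by
  rw [hf.1.quasiperiodic, mul_eq_zero, or_iff_right]
  exact one_div_ne_zero (mul_ne_zero (pow_ne_zero _ (p ^ 2).ne_zero) (pow_ne_zero _ x.ne_zero))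

lemma thetaSpace_apply_zpow_mul_eq_zero_iff (k : ℤ) (x : ℂˣ) :
    f ((p ^ 2) ^ k * x) = 0 ↔ f x = 0 := by
  induction k using Int.induction_on with
  | zero => simp
  | succ k ih => rw [zpow_add_one, mul_comm _ (p ^ 2), mul_assoc,
      thetaSpace_apply_mul_eq_zero_iff hf, ih]
  | pred k ih => rw [← thetaSpace_apply_mul_eq_zero_iff hf, ← mul_assoc, ← zpow_one_add,
      add_sub_cancel, ih]

lemma thetaSpace_apply_inv_eq_zero_iff (x : ℂˣ) : f x⁻¹ = 0 ↔ f x = 0 := by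
  rw [hf.1.inversion, mul_eq_zero, or_iff_right]
  exact neg_ne_zero.mpr (inv_ne_zero x.ne_zero)

/-- The functions in `V_n` vanish at `1`, fixed by `x ↦ x⁻¹`, and at `±p`, fixed by `x ↦ p² x⁻¹`,
because there the functional equations give `f x = -f x`. All zeros of `trivialFactor p` are obtained
from these by powers of `p²`. -/
lemma thetaSpace_apply_eq_zero_of_trivialFactor_eq_zero (hp : ‖(p : ℂ)‖ < 1) {v : ℂˣ}
    (hv : trivialFactor p v = 0) : f v = 0 := by
  have hp0 := p.ne_zero
  have hp2 := norm_pow_lt_one hp (k := 2) (by norm_num)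
  have hfix : ∀ y : ℂˣ, y ^ 2 = p ^ 2 → f y = 0 := by
    intro y hy
    have hy0 := y.ne_zero
    have h := hf.1.quasiperiodic y⁻¹
    have hyp : (p : ℂ) ^ 2 = (y : ℂ) ^ 2 := by exact_mod_cast (congrArg Units.val hy).symm
    rw [← hy, sq, mul_inv_cancel_right, hf.1.inversion] at h
    push_cast at h
    rw [inv_pow] at h
    have e : (y : ℂ) * f y = - (y : ℂ) * f y := by
      nth_rewrite 1 [h]
      field_simp
      ring
    have e' : (y : ℂ) * f y = 0 := by linear_combination e / 2
    exact (mul_eq_zero.mp e').resolve_left hy0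
  have key : ∀ (y : ℂˣ) (k : ℤ), y ^ 2 = p ^ 2 →
      (y : ℂ) * v = ((p : ℂ) ^ 2) ^ k → f v = 0 := by
    intro y k hy h
    have h' : v = (p ^ 2) ^ k * y⁻¹ := by
      rw [eq_mul_inv_iff_mul_eq, mul_comm]
      ext
      push_cast
      exact h
    rw [h', thetaSpace_apply_zpow_mul_eq_zero_iff hf, thetaSpace_apply_inv_eq_zero_iff hf,
      hfix y hy]
  rw [trivialFactor, mul_eq_zero, mul_eq_zero, ellTheta_eq_zero_iff hp2 (by positivity) v.ne_zero,
    ellTheta_eq_zero_iff hp2 (by positivity) (mul_ne_zero hp0 v.ne_zero),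
    ellTheta_eq_zero_iff hp2 (by positivity) (neg_ne_zero.mpr (mul_ne_zero hp0 v.ne_zero))] at hv
  rcases hv with (⟨k, hk⟩ | ⟨k, hk⟩) | ⟨k, hk⟩
  · have h' : v = (p ^ 2) ^ k * 1 := by
      ext
      simpa using hk
    rw [h', thetaSpace_apply_zpow_mul_eq_zero_iff hf]
    have h := hf.1.inversion 1
    simp only [inv_one, Units.val_one, neg_one_mul] at h
    linear_combination h / 2
  · exact key p k rfl hk
  · exact key (-p) k (neg_sq p) (by simpa using hk)

/-- By the three-term relation, a function in `V_n` that vanishes at `u` and `ω u` also vanishes at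
`ω² u`, hence at all zeros of `cauchyDenom p u`. -/
lemma thetaSpace_apply_eq_zero_of_cauchyDenom_eq_zero (hp : ‖(p : ℂ)‖ < 1) {u x : ℂˣ}
    (h0 : f u = 0) (h1 : f (cubicRoot * u) = 0) (hx : cauchyDenom p u x = 0) : f x = 0 := by
  have hall : ∀ l < 3, f (cubicRoot ^ l * u) = 0 := by
    have h := hf.2 u
    simp only [Finset.sum_range_succ, Finset.sum_range_zero, pow_zero, one_mul, pow_one, h0, h1,
      mul_zero, add_zero, zero_add] at h
    have h2 := (mul_eq_zero.mp h).resolve_left (pow_ne_zero 2 cubicRoot.ne_zero)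
    intro l hl
    interval_cases l <;> simpa
  obtain ⟨k, hk | hk⟩ := pow_three_eq_of_cauchyDenom_eq_zero hp hx
  · have hk' : x⁻¹ ^ 3 = ((p ^ 2) ^ (-k) * u) ^ 3 := by
      rw [inv_pow, hk, ← inv_pow, mul_inv, inv_inv, zpow_neg]
    obtain ⟨l, hl, h⟩ := exists_eq_cubicRoot_pow_mul hk'
    rw [← thetaSpace_apply_inv_eq_zero_iff hf, h, mul_left_comm,
      thetaSpace_apply_zpow_mul_eq_zero_iff hf, hall l hl]
  · obtain ⟨l, hl, h⟩ := exists_eq_cubicRoot_pow_mul hk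
    rw [h, mul_left_comm, thetaSpace_apply_zpow_mul_eq_zero_iff hf, hall l hl]

end

end

/-! ### Elements of `V_n` with prescribed zeros -/

section

variable {p : ℂˣ}

lemma hasSimpleZeros_ellTheta_mul {q c : ℂ} (hq : ‖q‖ < 1) (hq0 : q ≠ 0) (hc : c ≠ 0) :
    HasSimpleZeros fun z => ellTheta q (c * z) := by
  simpa using hasSimpleZeros_ellTheta_mul_pow hq hq0 hc one_ne_zero

lemma holomorphicOnUnits_ellTheta_mul {q c : ℂ} (hq : ‖q‖ < 1) (hc : c ≠ 0) :
    HolomorphicOnUnits fun z => ellTheta q (c * z) := by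
  simpa using holomorphicOnUnits_ellTheta_mul_pow hq hc 1

lemma trivialFactor_eq (v : ℂˣ) : trivialFactor p v =
    ellTheta ((p : ℂ) ^ 2) (1 * v) * ellTheta ((p : ℂ) ^ 2) (p * v) *
      ellTheta ((p : ℂ) ^ 2) (-p * v) := by
  rw [trivialFactor, one_mul, neg_mul]

lemma holomorphicOnUnits_trivialFactor (hp : ‖(p : ℂ)‖ < 1) :
    HolomorphicOnUnits (trivialFactor p) := by
  have hp2 := norm_pow_lt_one hp (k := 2) (by norm_num)
  rw [funext trivialFactor_eq]
  exact ((holomorphicOnUnits_ellTheta_mul hp2 one_ne_zero).mul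
    (holomorphicOnUnits_ellTheta_mul hp2 p.ne_zero)).mul
    (holomorphicOnUnits_ellTheta_mul hp2 (neg_ne_zero.mpr p.ne_zero))

lemma trivialFactor_mul (hp : ‖(p : ℂ)‖ < 1) (v : ℂˣ) :
    trivialFactor p (p ^ 2 * v) = ((p : ℂ) ^ 2 * (v : ℂ) ^ 3)⁻¹ * trivialFactor p v := by
  have hv := v.ne_zero
  have hp0 := p.ne_zero
  have hp2 := norm_pow_lt_one hp (k := 2) (by norm_num)
  have h1 := ellTheta_mul hp2 (by positivity) hv
  have h2 := ellTheta_mul hp2 (by positivity) (mul_ne_zero hp0 hv)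
  have h3 := ellTheta_mul hp2 (by positivity) (neg_ne_zero.mpr (mul_ne_zero hp0 hv))
  have e2 : (p : ℂ) * (p ^ 2 * v) = p ^ 2 * (p * v) := by ring
  have e3 : -((p : ℂ) ^ 2 * (p * v)) = p ^ 2 * -(p * v) := by ring
  rw [trivialFactor, trivialFactor, Units.val_mul, Units.val_pow_eq_pow_val, e2, e3, h1, h2, h3]
  field_simp

lemma log_norm_eq_of_eq_mul {a x : ℂ} (ha : a ≠ 0) (hx : x ≠ 0) {k : ℤ}
    (h : a * x = ((p : ℂ) ^ 2) ^ k) :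
    Real.log ‖x‖ = 2 * k * Real.log ‖(p : ℂ)‖ - Real.log ‖a‖ := by
  have h' := congrArg (fun x : ℂ => Real.log ‖x‖) h
  simp only [norm_mul, norm_zpow, norm_pow, Real.log_zpow, Real.log_pow] at h'
  rw [Real.log_mul (norm_ne_zero_iff.mpr ha) (norm_ne_zero_iff.mpr hx)] at h'
  push_cast at h'
  linarith

lemma log_norm_neg (hp : ‖(p : ℂ)‖ < 1) : Real.log ‖(p : ℂ)‖ < 0 :=
  Real.log_neg (norm_pos_iff.mpr p.ne_zero) hp

lemma log_norm_of_trivialFactor_eq_zero (hp : ‖(p : ℂ)‖ < 1) {v : ℂˣ}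
    (hv : trivialFactor p v = 0) : ∃ k : ℤ, Real.log ‖(v : ℂ)‖ = k * Real.log ‖(p : ℂ)‖ := by
  have hp0 := p.ne_zero
  have hv0 := v.ne_zero
  have hp2 := norm_pow_lt_one hp (k := 2) (by norm_num)
  rw [trivialFactor_eq, mul_eq_zero, mul_eq_zero,
    ellTheta_eq_zero_iff hp2 (by positivity) (mul_ne_zero one_ne_zero hv0),
    ellTheta_eq_zero_iff hp2 (by positivity) (mul_ne_zero hp0 hv0),
    ellTheta_eq_zero_iff hp2 (by positivity) (mul_ne_zero (neg_ne_zero.mpr hp0) hv0)] at hv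
  rcases hv with (⟨k, hk⟩ | ⟨k, hk⟩) | ⟨k, hk⟩
  · refine ⟨2 * k, ?_⟩
    have := log_norm_eq_of_eq_mul one_ne_zero hv0 hk
    push_cast
    simpa using this
  · refine ⟨2 * k - 1, ?_⟩
    have := log_norm_eq_of_eq_mul hp0 hv0 hk
    push_cast
    linarith
  · refine ⟨2 * k - 1, ?_⟩
    have := log_norm_eq_of_eq_mul (neg_ne_zero.mpr hp0) hv0 hk
    rw [norm_neg] at this
    push_cast
    linarith

lemma hasSimpleZeros_trivialFactor (hp : ‖(p : ℂ)‖ < 1) : HasSimpleZeros (trivialFactor p) := by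
  have hp0 := p.ne_zero
  have hp2 := norm_pow_lt_one hp (k := 2) (by norm_num)
  have hp20 : (p : ℂ) ^ 2 ≠ 0 := by positivity
  have hlog := (log_norm_neg hp).ne
  rw [funext trivialFactor_eq]
  refine ((hasSimpleZeros_ellTheta_mul hp2 hp20 one_ne_zero).mul
    (hasSimpleZeros_ellTheta_mul hp2 hp20 hp0) fun z hz hz' => ?_).mul
    (hasSimpleZeros_ellTheta_mul hp2 hp20 (neg_ne_zero.mpr hp0)) fun z hz hz' => ?_
  -- the absolute values of the zeros of the first two factors have different parities
  · have hz0 := z.ne_zero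
    rw [ellTheta_eq_zero_iff hp2 hp20 (mul_ne_zero one_ne_zero hz0)] at hz
    rw [ellTheta_eq_zero_iff hp2 hp20 (mul_ne_zero hp0 hz0)] at hz'
    obtain ⟨k, hk⟩ := hz
    obtain ⟨l, hl⟩ := hz'
    have h1 := log_norm_eq_of_eq_mul one_ne_zero hz0 hk
    have h2 := log_norm_eq_of_eq_mul hp0 hz0 hl
    rw [norm_one, Real.log_one, sub_zero, h2] at h1
    have h3 : (2 * l - 1 : ℝ) = 2 * k := mul_right_cancel₀ hlog (by linarith)
    have h4 : 2 * l - 1 = 2 * k := by exact_mod_cast h3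
    omega
  · have hz0 := z.ne_zero
    rw [mul_eq_zero, ellTheta_eq_zero_iff hp2 hp20 (mul_ne_zero one_ne_zero hz0),
      ellTheta_eq_zero_iff hp2 hp20 (mul_ne_zero hp0 hz0)] at hz
    rw [ellTheta_eq_zero_iff hp2 hp20 (mul_ne_zero (neg_ne_zero.mpr hp0) hz0)] at hz'
    obtain ⟨l, hl⟩ := hz'
    have h2 := log_norm_eq_of_eq_mul (neg_ne_zero.mpr hp0) hz0 hl
    rw [norm_neg] at h2
    rcases hz with ⟨k, hk⟩ | ⟨k, hk⟩
    · have h1 := log_norm_eq_of_eq_mul one_ne_zero hz0 hk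
      rw [norm_one, Real.log_one, sub_zero, h2] at h1
      have h3 : (2 * l - 1 : ℝ) = 2 * k := mul_right_cancel₀ hlog (by linarith)
      have h4 : 2 * l - 1 = 2 * k := by exact_mod_cast h3
      omega
    · have h1 := log_norm_eq_of_eq_mul hp0 hz0 hk
      rw [h2] at h1
      have h3 : (l : ℝ) = k := mul_right_cancel₀ hlog (by linarith)
      have h4 : l = k := by exact_mod_cast h3
      rw [h4, ← hk] at hl
      have h5 : (p : ℂ) * z = 0 := by linear_combination (-1 / 2 : ℂ) * hl
      exact mul_ne_zero hp0 hz0 h5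

/-- A family of points `u i` with `‖u i‖ = ‖p‖ ^ s i`, where the `s i ∈ (0, 1)` are distinct. For
such points the factors `cauchyDenom p (u i)` have simple zeros, which are different for different
`i` and are not zeros of `trivialFactor p`. -/
structure IsGeneric (p : ℂˣ) {ι : Type*} (u : ι → ℂˣ) (s : ι → ℝ) : Prop where
  log_norm : ∀ i, Real.log ‖(u i : ℂ)‖ = s i * Real.log ‖(p : ℂ)‖
  pos : ∀ i, 0 < s i
  lt_one : ∀ i, s i < 1
  injective : Function.Injective s

lemma exists_log_norm_eq (p : ℂˣ) (r : ℝ) :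
    ∃ t : ℂˣ, Real.log ‖(t : ℂ)‖ = r * Real.log ‖(p : ℂ)‖ := by
  have hp0 : 0 < ‖(p : ℂ)‖ := norm_pos_iff.mpr p.ne_zero
  refine ⟨Units.mk0 ((‖(p : ℂ)‖ ^ r : ℝ) : ℂ)
    (by exact_mod_cast (Real.rpow_pos_of_pos hp0 _).ne'), ?_⟩
  rw [Units.val_mk0, Complex.norm_real, Real.norm_of_nonneg (by positivity), Real.log_rpow hp0]

lemma exists_isGeneric (p : ℂˣ) (n : ℕ) :
    ∃ (u : Fin n → ℂˣ) (s : Fin n → ℝ), IsGeneric p u s := by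
  choose t ht using exists_log_norm_eq p
  refine ⟨fun i => t (((i : ℕ) + 1 : ℝ) / (n + 1)),
    fun i => ((i : ℕ) + 1 : ℝ) / (n + 1), fun i => ht _, fun i => by positivity, fun i => ?_,
    fun i j h => ?_⟩
  · rw [div_lt_one (by positivity)]
    have : ((i : ℕ) : ℝ) < n := by exact_mod_cast i.2
    linarith
  · have hn : (n + 1 : ℝ) ≠ 0 := by positivity
    have h' : ((i : ℕ) : ℝ) = (j : ℕ) := by
      have := (div_left_inj' hn).mp h
      linarith
    exact Fin.ext (by exact_mod_cast h')

namespace IsGeneric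

variable {ι : Type*} {u : ι → ℂˣ} {s : ι → ℝ}

lemma comp (h : IsGeneric p u s) {κ : Type*} {e : κ → ι} (he : Function.Injective e) :
    IsGeneric p (u ∘ e) (s ∘ e) :=
  ⟨fun _ => h.log_norm _, fun _ => h.pos _, fun _ => h.lt_one _, h.injective.comp he⟩

lemma exists_of_cauchyDenom_eq_zero (h : IsGeneric p u s) (hp : ‖(p : ℂ)‖ < 1) {i : ι} {x : ℂˣ}
    {r : ℝ} (hr : Real.log ‖(x : ℂ)‖ = r * Real.log ‖(p : ℂ)‖) (hx : cauchyDenom p (u i) x = 0) :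
    ∃ k : ℤ, r = 2 * k - s i ∨ r = 2 * k + s i := by
  obtain ⟨k, hk⟩ := log_norm_of_cauchyDenom_eq_zero hp hx
  rw [hr, h.log_norm] at hk
  exact ⟨k, hk.imp (fun hk => mul_right_cancel₀ (log_norm_neg hp).ne (by linarith))
    (fun hk => mul_right_cancel₀ (log_norm_neg hp).ne (by linarith))⟩

lemma trivialFactor_ne_zero (h : IsGeneric p u s) (hp : ‖(p : ℂ)‖ < 1) (i : ι) :
    trivialFactor p (u i) ≠ 0 := by
  intro h0
  obtain ⟨k, hk⟩ := log_norm_of_trivialFactor_eq_zero hp h0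
  rw [h.log_norm] at hk
  have hk' := mul_right_cancel₀ (log_norm_neg hp).ne hk
  have h1 := h.pos i
  have h2 := h.lt_one i
  rw [hk'] at h1 h2
  norm_cast at h1 h2
  omega

lemma cauchyDenom_ne_zero (h : IsGeneric p u s) (hp : ‖(p : ℂ)‖ < 1) {i j : ι} (hij : i ≠ j) :
    cauchyDenom p (u i) (u j) ≠ 0 := by
  intro h0
  obtain ⟨k, hk⟩ := h.exists_of_cauchyDenom_eq_zero hp (h.log_norm j) h0
  have hi := h.pos i
  have hi' := h.lt_one i
  have hj := h.pos j
  have hj' := h.lt_one j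
  rcases hk with hk | hk
  · have h1 : ((0 : ℤ) : ℝ) < k := by push_cast; linarith
    have h2 : (k : ℝ) < (1 : ℤ) := by push_cast; linarith
    rw [Int.cast_lt] at h1 h2
    omega
  · have h1 : ((-1 : ℤ) : ℝ) < k := by push_cast; linarith
    have h2 : (k : ℝ) < (1 : ℤ) := by push_cast; linarith
    rw [Int.cast_lt] at h1 h2
    obtain rfl : k = 0 := by omega
    exact hij (h.injective (by simpa using hk.symm))

lemma hasSimpleZeros_cauchyDenom (h : IsGeneric p u s) (hp : ‖(p : ℂ)‖ < 1) (i : ι) :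
    HasSimpleZeros (cauchyDenom p (u i)) := by
  have hu := (u i).ne_zero
  have hp0 := p.ne_zero
  have hp60 : (p : ℂ) ^ 6 ≠ 0 := by positivity
  have hp6 := norm_pow_lt_one hp (k := 6) (by norm_num)
  have hc : ((u i : ℂ) ^ 3) ≠ 0 := by positivity
  have h' := (HasSimpleZeros.inv_coe_pow 3).mul
    ((hasSimpleZeros_ellTheta_mul_pow hp6 hp60 hc three_ne_zero).mul
      (hasSimpleZeros_ellTheta_mul_pow hp6 hp60 (inv_ne_zero hc) three_ne_zero)
      fun z hz hz' => ?_) fun z hz => ?_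
  · simp only [mul_comm ((u i : ℂ) ^ 3), mul_comm ((u i : ℂ) ^ 3)⁻¹] at h'
    exact h'
  · have hz0 := z.ne_zero
    rw [ellTheta_eq_zero_iff hp6 hp60 (by positivity)] at hz hz'
    obtain ⟨k, hk⟩ := hz
    obtain ⟨l, hl⟩ := hz'
    have e : ((p : ℂ) ^ 6) = ((p ^ 3 : ℂˣ) : ℂ) ^ 2 := by push_cast; ring
    rw [e] at hk hl
    have h1 := log_norm_eq_of_eq_mul hc (by positivity) hk
    have h2 := log_norm_eq_of_eq_mul (inv_ne_zero hc) (by positivity) hl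
    rw [h1, norm_inv, Real.log_inv, norm_pow, Units.val_pow_eq_pow_val, norm_pow, Real.log_pow,
      Real.log_pow, h.log_norm] at h2
    push_cast at h2
    have h3 : (k : ℝ) - l = s i := mul_right_cancel₀ (log_norm_neg hp).ne (by linarith)
    have h4 := h.pos i
    have h5 := h.lt_one i
    rw [← h3] at h4 h5
    norm_cast at h4 h5
    omega
  · exact absurd hz (inv_ne_zero (pow_ne_zero 3 z.ne_zero))

lemma hasSimpleZeros [Fintype ι] (h : IsGeneric p u s) (hp : ‖(p : ℂ)‖ < 1) :
    HasSimpleZeros fun x => trivialFactor p x * ∏ i, cauchyDenom p (u i) x := by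
  refine (hasSimpleZeros_trivialFactor hp).mul (HasSimpleZeros.prod _
    (fun i _ => h.hasSimpleZeros_cauchyDenom hp i) fun i _ j _ hij x hx hx' => ?_) fun x hx => ?_
  · have hi := h.pos i
    have hi' := h.lt_one i
    have hj := h.pos j
    have hj' := h.lt_one j
    obtain ⟨r, hr⟩ : ∃ r, Real.log ‖(x : ℂ)‖ = r * Real.log ‖(p : ℂ)‖ :=
      ⟨_, (div_mul_cancel₀ _ (log_norm_neg hp).ne).symm⟩
    obtain ⟨k, hk⟩ := h.exists_of_cauchyDenom_eq_zero hp hr hx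
    obtain ⟨l, hl⟩ := h.exists_of_cauchyDenom_eq_zero hp hr hx'
    have hne : s i ≠ s j := h.injective.ne hij
    -- `s i ± s j` would be an even integer
    rcases hk with hk | hk <;> rcases hl with hl | hl
    · have h1 : ((-1 : ℤ) : ℝ) < k - l := by push_cast; linarith
      have h2 : (k - l : ℝ) < (1 : ℤ) := by push_cast; linarith
      norm_cast at h1 h2
      obtain rfl : k = l := by omega
      exact hne (by linarith)
    · have h1 : ((0 : ℤ) : ℝ) < k - l := by push_cast; linarith
      have h2 : (k - l : ℝ) < (1 : ℤ) := by push_cast; linarith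
      norm_cast at h1 h2
      omega
    · have h1 : ((0 : ℤ) : ℝ) < l - k := by push_cast; linarith
      have h2 : (l - k : ℝ) < (1 : ℤ) := by push_cast; linarith
      norm_cast at h1 h2
      omega
    · have h1 : ((-1 : ℤ) : ℝ) < k - l := by push_cast; linarith
      have h2 : (k - l : ℝ) < (1 : ℤ) := by push_cast; linarith
      norm_cast at h1 h2
      obtain rfl : k = l := by omega
      exact hne (by linarith)
  · refine Finset.prod_ne_zero_iff.mpr fun i _ hx' => ?_
    obtain ⟨k, hk⟩ := log_norm_of_trivialFactor_eq_zero hp hx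
    obtain ⟨l, hl⟩ := h.exists_of_cauchyDenom_eq_zero hp hk hx'
    have hi := h.pos i
    have hi' := h.lt_one i
    rcases hl with hl | hl
    · have h1 : (0 : ℝ) < 2 * l - k := by linarith
      have h2 : (2 * l - k : ℝ) < 1 := by linarith
      norm_cast at h1 h2
      omega
    · have h1 : (0 : ℝ) < k - 2 * l := by linarith
      have h2 : (k - 2 * l : ℝ) < 1 := by linarith
      norm_cast at h1 h2
      omega

/-- A function in `V_n` that vanishes at `u i` and `ω u i`, for generic `u 1, …, u n`, is determined
up to a constant: the product on the right has the same quasi-periodicity and only simple zeros, all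
of which are zeros of `f`, so the quotient is an elliptic function without poles. -/
lemma exists_eq_const_mul {n : ℕ} {u : Fin n → ℂˣ} {s : Fin n → ℝ} (h : IsGeneric p u s)
    (hp : ‖(p : ℂ)‖ < 1) {f : ℂˣ → ℂ} (hf : f ∈ thetaSpace p n)
    (h0 : ∀ i, f (u i) = 0) (h1 : ∀ i, f (cubicRoot * u i) = 0) :
    ∃ c : ℂ, ∀ x, f x = c * (trivialFactor p x * ∏ i, cauchyDenom p (u i) x) := by
  set P : ℂˣ → ℂ := fun x => trivialFactor p x * ∏ i, cauchyDenom p (u i) x with hP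
  obtain ⟨g, hg, hfg⟩ := h.hasSimpleZeros hp f hf.1.holomorphic fun x hx => by
    rcases mul_eq_zero.mp hx with hx | hx
    · exact thetaSpace_apply_eq_zero_of_trivialFactor_eq_zero hf hp hx
    · obtain ⟨i, -, hi⟩ := Finset.prod_eq_zero_iff.mp hx
      exact thetaSpace_apply_eq_zero_of_cauchyDenom_eq_zero hf hp (h0 i) (h1 i) hi
  have hPhol : HolomorphicOnUnits P := (holomorphicOnUnits_trivialFactor hp).mul
    (HolomorphicOnUnits.prod _ fun i _ => holomorphicOnUnits_cauchyDenom hp (u i))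
  have hPper : ∀ x, P (p ^ 2 * x) =
      1 / (((p ^ 2 : ℂˣ) : ℂ) ^ (3 * n + 1) * (x : ℂ) ^ (2 * (3 * n + 1) + 1)) * P x := by
    intro x
    have hx := x.ne_zero
    have hp0 := p.ne_zero
    simp only [hP, trivialFactor_mul hp, cauchyDenom_mul hp, Finset.prod_mul_distrib,
      Finset.prod_const, Finset.card_univ, Fintype.card_fin, inv_pow]
    push_cast
    field_simp
    ring
  by_cases hP0 : ∃ v, P v ≠ 0
  · obtain ⟨v, hv⟩ := hP0
    have hper : ∀ x, g (p ^ 2 * x) = g x := by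
      by_contra! hne
      obtain ⟨y, hy⟩ := hne
      obtain ⟨z, hz, hz'⟩ := ((hg.comp_mul_left (p ^ 2)).sub hg).exists_ne_zero_and_ne_zero hPhol
        (sub_ne_zero.mpr hy) hv
      have e := hf.1.quasiperiodic z
      rw [hfg, hfg] at e
      change g (p ^ 2 * z) * P (p ^ 2 * z) = _ * (g z * P z) at e
      rw [hPper, mul_left_comm] at e
      have hμ : 1 / (((p ^ 2 : ℂˣ) : ℂ) ^ (3 * n + 1) * (z : ℂ) ^ (2 * (3 * n + 1) + 1)) ≠ 0 :=
        one_div_ne_zero (mul_ne_zero (pow_ne_zero _ (p ^ 2).ne_zero) (pow_ne_zero _ z.ne_zero))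
      exact hz (sub_eq_zero.mpr (mul_right_cancel₀ hz' (mul_left_cancel₀ hμ e)))
    refine ⟨g 1, fun x => ?_⟩
    have hp2 : ‖((p ^ 2 : ℂˣ) : ℂ)‖ < 1 := by
      rw [Units.val_pow_eq_pow_val]
      exact norm_pow_lt_one hp two_ne_zero
    rw [hfg, hg.eq_const_of_periodic hp2 hper x 1]
  · push Not at hP0
    exact ⟨0, fun x => by rw [hfg, zero_mul]; exact mul_eq_zero_of_right _ (hP0 x)⟩

end IsGeneric

end

/-! ### Functions proportional to an alternant -/

/-- The determinant is linear in each row. -/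
lemma det_updateRow_mem {ι : Type*} [Fintype ι] [DecidableEq ι] {X : Type*}
    (V : Submodule ℂ (X → ℂ)) (A : Matrix ι ι ℂ) (i : ι) (r : X → ι → ℂ)
    (hr : ∀ j, (fun z => r z j) ∈ V) : (fun z => (A.updateRow i (r z)).det) ∈ V := by
  have h : (fun z => (A.updateRow i (r z)).det) =
      ∑ j, A.transpose.cramer (fun k => if j = k then 1 else 0) i • fun z => r z j := by
    funext z
    rw [← Matrix.cramer_transpose_apply]
    have := LinearMap.pi_apply_eq_sum_univ
      ((LinearMap.proj i : (ι → ℂ) →ₗ[ℂ] ℂ) ∘ₗ A.transpose.cramer) (r z)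
    simp only [LinearMap.comp_apply, LinearMap.proj_apply] at this
    rw [this, Finset.sum_apply]
    simp [mul_comm]
  rw [h]
  exact V.sum_mem fun j _ => V.smul_mem _ (hr j)

lemma det_updateCol_mem {ι : Type*} [Fintype ι] [DecidableEq ι] {X : Type*}
    (V : Submodule ℂ (X → ℂ)) (A : Matrix ι ι ℂ) (i : ι) (c : X → ι → ℂ)
    (hc : ∀ j, (fun z => c z j) ∈ V) : (fun z => (A.updateCol i (c z)).det) ∈ V := by
  have h := det_updateRow_mem V A.transpose i c hc
  simpa only [← Matrix.det_transpose (A.updateCol i _), Matrix.updateCol_transpose,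
    Matrix.updateRow_transpose, Matrix.transpose_transpose] using h

section

variable {m : ℕ}

lemma alternant_update_mem {V : Submodule ℂ (ℂˣ → ℂ)} {ψ : Fin m → ℂˣ → ℂ} (hψ : ∀ j, ψ j ∈ V)
    (x : Fin m → ℂˣ) (i : Fin m) : (fun z => alternant ψ (update x i z)) ∈ V := by
  have h := det_updateRow_mem V (Matrix.of fun i j => ψ j (x i)) i (fun z j => ψ j z) hψ
  convert h using 2 with z
  rw [alternant]
  congr 1
  ext a b
  rcases eq_or_ne a i with rfl | hne
  · simp
  · simp [hne]

lemma alternant_eq_zero_of_eq {ψ : Fin m → ℂˣ → ℂ} {x : Fin m → ℂˣ} {i j : Fin m} (hij : i ≠ j)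
    (h : x i = x j) : alternant ψ x = 0 :=
  Matrix.det_zero_of_row_eq hij (by ext k; simp [h])

lemma alternant_comp_perm (ψ : Fin m → ℂˣ → ℂ) (σ : Equiv.Perm (Fin m)) (x : Fin m → ℂˣ) :
    alternant ψ (x ∘ σ) = ((Equiv.Perm.sign σ : ℤ) : ℂ) * alternant ψ x := by
  rw [alternant, alternant, ← Matrix.det_permute]
  rfl

lemma continuous_alternant {ψ : Fin m → ℂˣ → ℂ} (hψ : ∀ j, Continuous (ψ j)) :
    Continuous (alternant ψ) :=
  Continuous.matrix_det (continuous_matrix fun i j => (hψ j).comp (continuous_apply i))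

variable {V : Submodule ℂ (ℂˣ → ℂ)} (ψ : Module.Basis (Fin m) ℂ V)

lemma eq_zero_of_alternant_ne_zero {x : Fin m → ℂˣ}
    (hx : alternant (fun j => (ψ j : ℂˣ → ℂ)) x ≠ 0) {f : ℂˣ → ℂ} (hf : f ∈ V)
    (h0 : ∀ i, f (x i) = 0) : f = 0 := by
  have hsum : ∀ z, f z = ∑ j, ψ.repr ⟨f, hf⟩ j * (ψ j : ℂˣ → ℂ) z := by
    intro z
    have h : (((∑ j, ψ.repr ⟨f, hf⟩ j • ψ j : V) : ℂˣ → ℂ)) z = f z := by rw [ψ.sum_repr]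
    rw [← h, Submodule.coe_sum, Finset.sum_apply]
    rfl
  have hc := Matrix.eq_zero_of_mulVec_eq_zero hx (v := ψ.repr ⟨f, hf⟩) (by
    funext i
    simpa [Matrix.mulVec, dotProduct, mul_comm, h0] using (hsum (x i)).symm)
  funext z
  simp [hsum, hc]

lemma alternant_ne_zero {x : Fin m → ℂˣ} (h : ∀ f ∈ V, (∀ i, f (x i) = 0) → f = 0) :
    alternant (fun j => (ψ j : ℂˣ → ℂ)) x ≠ 0 := by
  intro h0
  obtain ⟨c, hc, hc0⟩ := Matrix.exists_mulVec_eq_zero_iff.mpr h0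
  have hf := h (∑ j, c j • ψ j : V) (Submodule.coe_mem _) fun i => by
    simpa [Matrix.mulVec, dotProduct, mul_comm, Finset.sum_apply] using congrFun hc0 i
  exact hc (funext (Fintype.linearIndependent_iff.mp ψ.linearIndependent c (Subtype.ext hf)))

/-- Two functions of several variables that are holomorphic in the variables `S` and do not vanish
identically when the other variables are fixed are nonzero at a common point. -/
lemma exists_ne_zero_and_ne_zero_of_forall_update {F G : (Fin m → ℂˣ) → ℂ} (S : Finset (Fin m))
    (hF : ∀ i ∈ S, ∀ x, HolomorphicOnUnits fun z => F (update x i z))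
    (hG : ∀ i ∈ S, ∀ x, HolomorphicOnUnits fun z => G (update x i z)) {x y : Fin m → ℂˣ}
    (hxy : ∀ i ∉ S, x i = y i) (hx : F x ≠ 0) (hy : G y ≠ 0) :
    ∃ z : Fin m → ℂˣ, (∀ i ∉ S, z i = y i) ∧ F z ≠ 0 ∧ G z ≠ 0 := by
  induction S using Finset.induction_on generalizing x y with
  | empty =>
    obtain rfl : x = y := funext fun i => hxy i (Finset.notMem_empty i)
    exact ⟨x, fun _ _ => rfl, hx, hy⟩
  | insert a S ha ih =>
    obtain ⟨w, hw, hw'⟩ := (hF a (Finset.mem_insert_self a S) x).exists_ne_zero_and_ne_zero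
      (hG a (Finset.mem_insert_self a S) y) (x := x a) (y := y a)
      (by rwa [update_eq_self]) (by rwa [update_eq_self])
    obtain ⟨z, hz, hFz, hGz⟩ := ih (fun i hi => hF i (Finset.mem_insert_of_mem hi))
      (fun i hi => hG i (Finset.mem_insert_of_mem hi)) (x := update x a w) (y := update y a w)
      (fun i hi => by
        rcases eq_or_ne i a with rfl | hne
        · simp
        · simpa [hne] using hxy i (by simp [hne, hi])) hw hw'
    refine ⟨z, fun i hi => ?_, hFz, hGz⟩
    rw [Finset.mem_insert, not_or] at hi
    rw [hz i hi.2, update_of_ne hi.1]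

section

variable {F : (Fin m → ℂˣ) → ℂ} (hF0 : ∀ x i j, i ≠ j → x i = x j → F x = 0)

include hF0

/-- Both sides, as functions of `z`, belong to `V` and agree at the points `x 1, …, x m`. -/
lemma apply_update_mul_alternant {i : Fin m} {x : Fin m → ℂˣ}
    (hF : (fun z => F (update x i z)) ∈ V)
    (hx : alternant (fun j => (ψ j : ℂˣ → ℂ)) x ≠ 0) (z : ℂˣ) :
    F (update x i z) * alternant (fun j => (ψ j : ℂˣ → ℂ)) x =
      F x * alternant (fun j => (ψ j : ℂˣ → ℂ)) (update x i z) := by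
  set D := alternant (fun j => (ψ j : ℂˣ → ℂ)) with hD
  have hmem : (D x • fun z => F (update x i z)) - (F x • fun z => D (update x i z)) ∈ V :=
    V.sub_mem (V.smul_mem _ hF) (V.smul_mem _ (alternant_update_mem (fun j => (ψ j).2) x i))
  have h := congrFun (eq_zero_of_alternant_ne_zero ψ hx hmem fun j => by
    simp only [Pi.sub_apply, Pi.smul_apply, smul_eq_mul]
    rcases eq_or_ne j i with rfl | hne
    · rw [update_eq_self, mul_comm, sub_self]
    · have e : update x i (x j) i = update x i (x j) j := by simp [hne]
      rw [hF0 _ i j hne.symm e, hD, alternant_eq_zero_of_eq hne.symm e, mul_zero, mul_zero,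
        sub_self]) z
  simp only [Pi.sub_apply, Pi.smul_apply, smul_eq_mul, Pi.zero_apply] at h
  linear_combination h

/-- If `F` belongs to `V` in each of the variables `S` and vanishes whenever two variables coincide,
then the quotient of `F` by the alternant of a basis of `V` does not depend on the variables `S`:
changing them one at a time, one connects two points through points where the alternant is
nonzero. -/
lemma mul_alternant_eq_mul_alternant (hV : ∀ f ∈ V, HolomorphicOnUnits f) (S : Finset (Fin m))
    (hF : ∀ i ∈ S, ∀ x, (fun z => F (update x i z)) ∈ V) {x y : Fin m → ℂˣ}
    (hxy : ∀ i ∉ S, x i = y i) (hy : alternant (fun j => (ψ j : ℂˣ → ℂ)) y ≠ 0) :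
    F x * alternant (fun j => (ψ j : ℂˣ → ℂ)) y = F y * alternant (fun j => (ψ j : ℂˣ → ℂ)) x := by
  set D := alternant (fun j => (ψ j : ℂˣ → ℂ)) with hD
  have hDmem : ∀ (i : Fin m) x, (fun z => D (update x i z)) ∈ V := fun i x =>
    alternant_update_mem (fun j => (ψ j).2) x i
  have key : ∀ x y : Fin m → ℂˣ, (∀ i ∉ S, x i = y i) → D x ≠ 0 → D y ≠ 0 →
      F x * D y = F y * D x := by
    clear hxy hy x y
    induction S using Finset.induction_on with
    | empty =>
      intro x y hxy _ _
      obtain rfl : x = y := funext fun i => hxy i (Finset.notMem_empty i)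
      rfl
    | insert a S ha ih =>
      intro x y hxy hx hy
      have hFa := hF a (Finset.mem_insert_self a S)
      obtain ⟨w, hw, hw'⟩ := (hV _ (hDmem a x)).exists_ne_zero_and_ne_zero (hV _ (hDmem a y))
        (x := x a) (y := y a) (by rwa [update_eq_self]) (by rwa [update_eq_self])
      have h := ih (fun i hi => hF i (Finset.mem_insert_of_mem hi)) (update x a w) (update y a w)
        (fun i hi => by
          rcases eq_or_ne i a with rfl | hne
          · simp
          · simpa [hne] using hxy i (by simp [hne, hi])) hw hw'
      have h1 := apply_update_mul_alternant ψ hF0 (hFa x) hx w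
      have h2 := apply_update_mul_alternant ψ hF0 (hFa y) hy w
      rw [← hD] at h1 h2
      refine mul_right_cancel₀ (mul_ne_zero hw hw') ?_
      linear_combination D x * D y * h - D y * D (update y a w) * h1
        + D x * D (update x a w) * h2
  by_contra hne
  obtain ⟨z, hz, hGz, hDz⟩ := exists_ne_zero_and_ne_zero_of_forall_update
    (F := fun x => F x * D y - F y * D x) (G := D) S
    (fun i hi x => ((hV _ (hF i hi x)).mul (.const _)).sub ((HolomorphicOnUnits.const _).mul
      (hV _ (hDmem i x)))) (fun i _ x => hV _ (hDmem i x)) hxy (sub_ne_zero.mpr hne) hy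
  exact hGz (sub_eq_zero.mpr (key z y hz hDz hy))

end

end

/-! ### The numerator of `Ψ_n` -/

lemma det_mul_prod_erase {ι R : Type*} [Fintype ι] [DecidableEq ι] [CommRing R] (a c : ι → ι → R) :
    (Matrix.of fun k i => a k i * ∏ l ∈ Finset.univ.erase k, c l i).det =
      (Matrix.of fun k i => a k i * ∏ l ∈ Finset.univ.erase i, c k l).det := by
  simp only [Matrix.det_apply', Matrix.of_apply, Finset.prod_mul_distrib]
  refine Finset.sum_congr rfl fun σ _ => ?_
  congr 2
  calc ∏ i, ∏ l ∈ Finset.univ.erase (σ i), c l i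
      = ∏ i, ∏ l ∈ Finset.univ.erase i, c (σ l) i :=
        Finset.prod_congr rfl fun i _ => (Finset.prod_equiv σ (by simp) (by simp)).symm
    _ = ∏ l, ∏ i ∈ Finset.univ.erase l, c (σ l) i :=
        Finset.prod_comm' (by simp [eq_comm])

/-- The numerator `∏ cauchyDenom · det (Ψ_1 / cauchyDenom)` of `Ψ_n`, with the denominators
multiplied into the columns of the determinant, so that it is defined everywhere. -/
def psiNumerator (p : ℂˣ) {n : ℕ} (φ : Fin 3 → ℂˣ → ℂ) (t u : Fin n → ℂˣ) (v : ℂˣ) : ℂ :=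
  (Matrix.of fun k i => alternant φ ![t k, u i, v] *
    ∏ l ∈ Finset.univ.erase k, cauchyDenom p (t l) (u i)).det

section

variable {p : ℂˣ} {n : ℕ}

lemma psiNumerator_eq (φ : Fin 3 → ℂˣ → ℂ) (t u : Fin n → ℂˣ) (v : ℂˣ) :
    psiNumerator p φ t u v = (Matrix.of fun k i => alternant φ ![t k, u i, v] *
      ∏ l ∈ Finset.univ.erase i, cauchyDenom p (t k) (u l)).det :=
  det_mul_prod_erase _ fun k i => cauchyDenom p (t k) (u i)

lemma psiQuotient_eq {φ : Fin 3 → ℂˣ → ℂ} {x : Fin (2 * n + 1) → ℂˣ} (hx : x ∈ psiRegular p n) :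
    psiQuotient p n φ x =
      psiNumerator p φ (tVar x) (uVar x) (vVar x) / trivialFactor p (vVar x) ^ (n - 1) := by
  have h := Matrix.det_mul_row (fun j : Fin n => ∏ i : Fin n, cauchyDenom p (tVar x i) (uVar x j))
    (Matrix.of fun i j : Fin n =>
      alternant φ ![tVar x i, uVar x j, vVar x] / cauchyDenom p (tVar x i) (uVar x j))
  rw [psiQuotient, div_mul_eq_mul_div, Finset.prod_comm, ← h, psiNumerator]
  congr 3
  ext k i
  have hne := hx.1 k i
  simp only [Matrix.of_apply]
  rw [← Finset.mul_prod_erase _ _ (Finset.mem_univ k)]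
  field_simp

variable {φ : Fin 3 → ℂˣ → ℂ}

lemma update_zero_vec_three {α : Type*} (a b c z : α) : update ![a, b, c] 0 z = ![z, b, c] := by
  funext k
  fin_cases k <;> rfl

lemma update_one_vec_three {α : Type*} (a b c z : α) : update ![a, b, c] 1 z = ![a, z, c] := by
  funext k
  fin_cases k <;> rfl

lemma update_two_vec_three {α : Type*} (a b c z : α) : update ![a, b, c] 2 z = ![a, b, z] := by
  funext k
  fin_cases k <;> rfl

lemma alternant_last_mem (hφ : ∀ j, φ j ∈ thetaSpace p 1) (a b : ℂˣ) :
    (fun z => alternant φ ![a, b, z]) ∈ thetaSpace p 1 := by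
  simpa only [update_two_vec_three] using alternant_update_mem hφ ![a, b, 1] 2

lemma psiNumerator_update_right_mem (hp : ‖(p : ℂ)‖ < 1) (hφ : ∀ j, φ j ∈ thetaSpace p 1)
    (t u : Fin n → ℂˣ) (v : ℂˣ) (i : Fin n) :
    (fun z => psiNumerator p φ t (update u i z) v) ∈ thetaSpace p n := by
  have h := det_updateCol_mem (thetaSpace p n) (Matrix.of fun k i => alternant φ ![t k, u i, v] *
    ∏ l ∈ Finset.univ.erase k, cauchyDenom p (t l) (u i)) i
    (fun z k => alternant φ ![t k, z, v] * ∏ l ∈ Finset.univ.erase k, cauchyDenom p (t l) z)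
    fun k => by
      have h1 : (fun z => alternant φ ![t k, z, v]) ∈ thetaSpace p 1 := by
        simpa only [update_one_vec_three] using alternant_update_mem hφ ![t k, 1, v] 1
      have h2 := mul_prod_cauchyDenom_mem_thetaSpace hp h1 (Finset.univ.erase k) t
      have hn : 1 + (Finset.univ.erase k).card = n := by
        rw [Finset.card_erase_of_mem (Finset.mem_univ k), Finset.card_univ, Fintype.card_fin]
        have := k.2
        omega
      rwa [hn] at h2
  convert h using 2 with z
  rw [psiNumerator]
  congr 1
  ext k j
  rcases eq_or_ne j i with rfl | hne
  · simp
  · simp [hne]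

lemma psiNumerator_update_left_mem (hp : ‖(p : ℂ)‖ < 1) (hφ : ∀ j, φ j ∈ thetaSpace p 1)
    (t u : Fin n → ℂˣ) (v : ℂˣ) (k : Fin n) :
    (fun z => psiNumerator p φ (update t k z) u v) ∈ thetaSpace p n := by
  have h := det_updateRow_mem (thetaSpace p n) (Matrix.of fun k i => alternant φ ![t k, u i, v] *
    ∏ l ∈ Finset.univ.erase i, cauchyDenom p (t k) (u l)) k
    (fun z i => alternant φ ![z, u i, v] * ∏ l ∈ Finset.univ.erase i, cauchyDenom p z (u l))
    fun i => by
      have h1 : (fun z => alternant φ ![z, u i, v]) ∈ thetaSpace p 1 := by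
        simpa only [update_zero_vec_three] using alternant_update_mem hφ ![1, u i, v] 0
      have h2 := mul_prod_cauchyDenom_mem_thetaSpace hp h1 (Finset.univ.erase i) u
      have hn : 1 + (Finset.univ.erase i).card = n := by
        rw [Finset.card_erase_of_mem (Finset.mem_univ i), Finset.card_univ, Fintype.card_fin]
        have := i.2
        omega
      rw [hn] at h2
      convert (thetaSpace p n).smul_mem ((-1) ^ (Finset.univ.erase i).card) h2 using 2 with z
      simp only [cauchyDenom_swap hp z, Finset.prod_neg, Pi.smul_apply, smul_eq_mul]
      ring
  convert h using 2 with z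
  rw [psiNumerator_eq]
  congr 1
  ext l j
  rcases eq_or_ne l k with rfl | hne
  · simp
  · simp [hne]

lemma holomorphicOnUnits_psiNumerator (hφ : ∀ j, φ j ∈ thetaSpace p 1) (t u : Fin n → ℂˣ) :
    HolomorphicOnUnits (psiNumerator p φ t u) := by
  refine HolomorphicOnUnits.det fun k i => HolomorphicOnUnits.mul ?_ (.const _)
  exact (alternant_last_mem hφ (t k) (u i)).1.holomorphic

lemma psiNumerator_eq_zero_of_left_eq {t u : Fin n → ℂˣ} {v : ℂˣ} {k l : Fin n} (hkl : k ≠ l)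
    (h : t k = t l) : psiNumerator p φ t u v = 0 := by
  rw [psiNumerator_eq]
  exact Matrix.det_zero_of_row_eq hkl (by ext i; simp [h])

lemma psiNumerator_eq_zero_of_right_eq {t u : Fin n → ℂˣ} {v : ℂˣ} {i j : Fin n} (hij : i ≠ j)
    (h : u i = u j) : psiNumerator p φ t u v = 0 :=
  Matrix.det_zero_of_column_eq hij fun k => by simp [h]

lemma psiNumerator_eq_zero_of_left_eq_last {t u : Fin n → ℂˣ} {v : ℂˣ} {k : Fin n} (h : t k = v) :
    psiNumerator p φ t u v = 0 :=
  Matrix.det_eq_zero_of_row_eq_zero k fun i => by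
    have h0 : alternant φ ![t k, u i, v] = 0 :=
      alternant_eq_zero_of_eq (i := 0) (j := 2) (by decide) (by simp [h])
    simp [h0]

lemma psiNumerator_eq_zero_of_right_eq_last {t u : Fin n → ℂˣ} {v : ℂˣ} {i : Fin n}
    (h : u i = v) : psiNumerator p φ t u v = 0 :=
  Matrix.det_eq_zero_of_column_eq_zero i fun k => by
    have h0 : alternant φ ![t k, u i, v] = 0 :=
      alternant_eq_zero_of_eq (i := 1) (j := 2) (by decide) (by simp [h])
    simp [h0]

/-- In the column of `u i = t k`, the diagonal position contains a vanishing alternant and all other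
entries contain the factor `cauchyDenom p (t k) (u i) = 0`. -/
lemma psiNumerator_eq_zero_of_left_eq_right {t u : Fin n → ℂˣ} {v : ℂˣ} {k i : Fin n}
    (h : t k = u i) : psiNumerator p φ t u v = 0 :=
  Matrix.det_eq_zero_of_column_eq_zero i fun l => by
    rw [Matrix.of_apply]
    rcases eq_or_ne l k with rfl | hne
    · rw [alternant_eq_zero_of_eq (i := 0) (j := 1) (by decide) (by simp [h]), zero_mul]
    · rw [Finset.prod_eq_zero (i := k) (by simp [hne.symm]) (by rw [h, cauchyDenom_self]),
        mul_zero]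

/-- If `t k = ω u k` for all `k`, then the matrix defining the numerator is diagonal. -/
lemma psiNumerator_cubicRoot_mul (u : Fin n → ℂˣ) (v : ℂˣ) :
    psiNumerator p φ (fun k => cubicRoot * u k) u v =
      ∏ k, (alternant φ ![cubicRoot * u k, u k, v] *
        ∏ l ∈ Finset.univ.erase k, cauchyDenom p (cubicRoot * u l) (u k)) := by
  rw [psiNumerator, ← Matrix.det_diagonal]
  congr 1
  ext k i
  rcases eq_or_ne k i with rfl | hne
  · simp
  · rw [Matrix.diagonal_apply_ne _ hne, Matrix.of_apply, Finset.prod_eq_zero (i := i)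
      (by simp [hne.symm]) (cauchyDenom_cubicRoot_mul_self _), mul_zero]

/-! ### The variables `t`, `u`, `v` -/

/-- The index of the variable `t i`. -/
def tIndex (i : Fin n) : Fin (2 * n + 1) := ⟨i, by omega⟩

/-- The index of the variable `u j`. -/
def uIndex (j : Fin n) : Fin (2 * n + 1) := ⟨n + j, by omega⟩

lemma index_cases (k : Fin (2 * n + 1)) :
    (∃ i, k = tIndex i) ∨ (∃ j, k = uIndex j) ∨ k = Fin.last (2 * n) := by
  rcases lt_or_ge (k : ℕ) n with h | h
  · exact .inl ⟨⟨k, h⟩, rfl⟩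
  · rcases lt_or_ge (k : ℕ) (2 * n) with h' | h'
    · exact .inr (.inl ⟨⟨k - n, by omega⟩, Fin.ext (by simp [uIndex]; omega)⟩)
    · exact .inr (.inr (Fin.ext (by simp; omega)))

lemma tIndex_inj {i j : Fin n} : tIndex i = tIndex j ↔ i = j := by
  simp [tIndex, Fin.ext_iff]

lemma uIndex_inj {i j : Fin n} : uIndex i = uIndex j ↔ i = j := by
  simp [uIndex, Fin.ext_iff]

lemma tIndex_ne_uIndex (i j : Fin n) : tIndex i ≠ uIndex j := by
  simp [tIndex, uIndex, Fin.ext_iff]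
  omega

lemma tIndex_ne_last (i : Fin n) : tIndex i ≠ Fin.last (2 * n) := by
  simp [tIndex, Fin.ext_iff]
  omega

lemma uIndex_ne_last (i : Fin n) : uIndex i ≠ Fin.last (2 * n) := by
  simp [uIndex, Fin.ext_iff]
  omega

section

variable (x : Fin (2 * n + 1) → ℂˣ) (z : ℂˣ)

lemma tVar_update_tIndex (i : Fin n) : tVar (update x (tIndex i) z) = update (tVar x) i z := by
  funext k
  change update x (tIndex i) z (tIndex k) = _
  rcases eq_or_ne k i with rfl | hne
  · simp
  · rw [update_of_ne (tIndex_inj.not.mpr hne), update_of_ne hne]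
    rfl

lemma uVar_update_tIndex (i : Fin n) : uVar (update x (tIndex i) z) = uVar x :=
  funext fun k => update_of_ne (tIndex_ne_uIndex i k).symm _ _

lemma vVar_update_tIndex (i : Fin n) : vVar (update x (tIndex i) z) = vVar x :=
  update_of_ne (tIndex_ne_last i).symm _ _

lemma uVar_update_uIndex (i : Fin n) : uVar (update x (uIndex i) z) = update (uVar x) i z := by
  funext k
  change update x (uIndex i) z (uIndex k) = _
  rcases eq_or_ne k i with rfl | hne
  · simp
  · rw [update_of_ne (uIndex_inj.not.mpr hne), update_of_ne hne]
    rfl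

lemma tVar_update_uIndex (i : Fin n) : tVar (update x (uIndex i) z) = tVar x :=
  funext fun k => update_of_ne (tIndex_ne_uIndex k i) _ _

lemma vVar_update_uIndex (i : Fin n) : vVar (update x (uIndex i) z) = vVar x :=
  update_of_ne (uIndex_ne_last i).symm _ _

lemma tVar_update_last : tVar (update x (Fin.last _) z) = tVar x :=
  funext fun k => update_of_ne (tIndex_ne_last k) _ _

lemma uVar_update_last : uVar (update x (Fin.last _) z) = uVar x :=
  funext fun k => update_of_ne (uIndex_ne_last k) _ _

lemma vVar_update_last : vVar (update x (Fin.last _) z) = z :=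
  update_self _ _ _

end

/-- The numerator of `Ψ_n` as a function of all variables. -/
def psiNumeratorVar (p : ℂˣ) (n : ℕ) (φ : Fin 3 → ℂˣ → ℂ) (x : Fin (2 * n + 1) → ℂˣ) : ℂ :=
  psiNumerator p φ (tVar x) (uVar x) (vVar x)

lemma psiNumeratorVar_update_mem (hp : ‖(p : ℂ)‖ < 1) (hφ : ∀ j, φ j ∈ thetaSpace p 1)
    {k : Fin (2 * n + 1)} (hk : k ≠ Fin.last (2 * n)) (x : Fin (2 * n + 1) → ℂˣ) :
    (fun z => psiNumeratorVar p n φ (update x k z)) ∈ thetaSpace p n := by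
  unfold psiNumeratorVar
  obtain ⟨i, rfl⟩ | ⟨i, rfl⟩ | rfl := index_cases k
  · simp only [tVar_update_tIndex, uVar_update_tIndex, vVar_update_tIndex]
    exact psiNumerator_update_left_mem hp hφ _ _ _ i
  · simp only [tVar_update_uIndex, uVar_update_uIndex, vVar_update_uIndex]
    exact psiNumerator_update_right_mem hp hφ _ _ _ i
  · exact absurd rfl hk

lemma psiNumeratorVar_eq_zero_of_eq {x : Fin (2 * n + 1) → ℂˣ} {k l : Fin (2 * n + 1)}
    (hkl : k ≠ l) (h : x k = x l) : psiNumeratorVar p n φ x = 0 := by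
  obtain ⟨i, rfl⟩ | ⟨i, rfl⟩ | rfl := index_cases k <;>
    obtain ⟨j, rfl⟩ | ⟨j, rfl⟩ | rfl := index_cases l
  · exact psiNumerator_eq_zero_of_left_eq (tIndex_inj.not.mp hkl) h
  · exact psiNumerator_eq_zero_of_left_eq_right h
  · exact psiNumerator_eq_zero_of_left_eq_last h
  · exact psiNumerator_eq_zero_of_left_eq_right h.symm
  · exact psiNumerator_eq_zero_of_right_eq (uIndex_inj.not.mp hkl) h
  · exact psiNumerator_eq_zero_of_right_eq_last h
  · exact psiNumerator_eq_zero_of_left_eq_last h.symm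
  · exact psiNumerator_eq_zero_of_right_eq_last h.symm
  · exact absurd rfl hkl

end

section

variable {p : ℂˣ} {n : ℕ}

/-! ### The constant of proportionality -/

/-- The point with `t k = ω u k` and last variable `v`. -/
def cubicPoint (u : Fin n → ℂˣ) (v : ℂˣ) (k : Fin (2 * n + 1)) : ℂˣ :=
  if h : (k : ℕ) < n then cubicRoot * u ⟨k, h⟩
  else if h' : (k : ℕ) < 2 * n then u ⟨k - n, by omega⟩ else v

lemma tVar_cubicPoint (u : Fin n → ℂˣ) (v : ℂˣ) :
    tVar (cubicPoint u v) = fun k => cubicRoot * u k :=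
  funext fun k => dif_pos k.2

lemma uVar_cubicPoint (u : Fin n → ℂˣ) (v : ℂˣ) : uVar (cubicPoint u v) = u := by
  funext k
  have hk := k.2
  simp [uVar, cubicPoint, show n + (k : ℕ) < 2 * n by omega]

lemma vVar_cubicPoint (u : Fin n → ℂˣ) (v : ℂˣ) : vVar (cubicPoint u v) = v := by
  simp [vVar, cubicPoint, show ¬ 2 * n < n by omega]

lemma update_cubicPoint_last (u : Fin n → ℂˣ) (v w : ℂˣ) :
    update (cubicPoint u v) (Fin.last _) w = cubicPoint u w := by
  funext k
  obtain ⟨i, rfl⟩ | ⟨i, rfl⟩ | rfl := index_cases k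
  · rw [update_of_ne (tIndex_ne_last i)]
    exact (congrFun (tVar_cubicPoint u v) i).trans (congrFun (tVar_cubicPoint u w) i).symm
  · rw [update_of_ne (uIndex_ne_last i)]
    exact (congrFun (uVar_cubicPoint u v) i).trans (congrFun (uVar_cubicPoint u w) i).symm
  · rw [update_self]
    exact (vVar_cubicPoint u w).symm

/-- At `t k = ω u k`, each `Ψ_1 (t k, u k, v)` is a multiple of
`trivialFactor p v * cauchyDenom p (u k) v`. -/
lemma exists_psiNumeratorVar_cubicPoint (hp : ‖(p : ℂ)‖ < 1) {φ : Fin 3 → ℂˣ → ℂ}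
    (hφ : ∀ j, φ j ∈ thetaSpace p 1) {u : Fin n → ℂˣ} {s : Fin n → ℝ} (hu : IsGeneric p u s) :
    ∃ c : ℂ, ∀ v, psiNumeratorVar p n φ (cubicPoint u v) =
      c * (trivialFactor p v ^ n * ∏ k, cauchyDenom p (u k) v) := by
  have h : ∀ k, ∃ c : ℂ, ∀ v, alternant φ ![cubicRoot * u k, u k, v] =
      c * (trivialFactor p v * cauchyDenom p (u k) v) := by
    intro k
    have hk : IsGeneric p (u ∘ fun _ : Fin 1 => k) (s ∘ fun _ : Fin 1 => k) :=
      hu.comp (injective_of_subsingleton _)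
    obtain ⟨c, hc⟩ := hk.exists_eq_const_mul hp (alternant_last_mem hφ (cubicRoot * u k) (u k))
      (fun _ => alternant_eq_zero_of_eq (i := 1) (j := 2) (by decide) rfl)
      (fun _ => alternant_eq_zero_of_eq (i := 0) (j := 2) (by decide) rfl)
    exact ⟨c, fun v => by simpa using hc v⟩
  choose c hc using h
  refine ⟨∏ k, (c k * ∏ l ∈ Finset.univ.erase k, cauchyDenom p (cubicRoot * u l) (u k)),
    fun v => ?_⟩
  rw [psiNumeratorVar, tVar_cubicPoint, uVar_cubicPoint, vVar_cubicPoint,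
    psiNumerator_cubicRoot_mul]
  simp only [hc, Finset.prod_mul_distrib, Finset.prod_const, Finset.card_univ, Fintype.card_fin]
  ring

/-- The last variable of `cubicPoint` may be chosen such that the alternant of a basis of `V_n` is
nonzero; as a function of that variable the alternant is a known product. -/
lemma exists_alternant_cubicPoint (hp : ‖(p : ℂ)‖ < 1)
    (ψ : Module.Basis (Fin (2 * n + 1)) ℂ (thetaSpace p n)) :
    ∃ (u : Fin n → ℂˣ) (s : Fin n → ℝ), IsGeneric p u s ∧
      ∃ (c : ℂ) (w : ℂˣ), c ≠ 0 ∧ trivialFactor p w * ∏ k, cauchyDenom p (u k) w ≠ 0 ∧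
        ∀ v, alternant (fun j => (ψ j : ℂˣ → ℂ)) (cubicPoint u v) =
          c * (trivialFactor p v * ∏ k, cauchyDenom p (u k) v) := by
  obtain ⟨u', s', h'⟩ := exists_isGeneric p (n + 1)
  have hu := h'.comp (Fin.castSucc_injective n)
  set u : Fin n → ℂˣ := u' ∘ Fin.castSucc with hu_def
  set w := u' (Fin.last n) with hw
  have hP : trivialFactor p w * ∏ k, cauchyDenom p (u k) w ≠ 0 :=
    mul_ne_zero (h'.trivialFactor_ne_zero hp _) (Finset.prod_ne_zero_iff.mpr fun k _ =>
      h'.cauchyDenom_ne_zero hp (Fin.castSucc_lt_last k).ne)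
  have hD : alternant (fun j => (ψ j : ℂˣ → ℂ)) (cubicPoint u w) ≠ 0 := by
    refine alternant_ne_zero ψ fun f hf h0 => ?_
    have ht : ∀ k, f (cubicRoot * u k) = 0 := fun k => by
      rw [← congrFun (tVar_cubicPoint u w) k]
      exact h0 _
    have hu0 : ∀ k, f (u k) = 0 := fun k => by
      rw [← congrFun (uVar_cubicPoint u w) k]
      exact h0 _
    obtain ⟨c, hc⟩ := hu.exists_eq_const_mul hp hf hu0 ht
    have hw0 : f w = 0 := by
      rw [← vVar_cubicPoint u w]
      exact h0 _
    rw [hc] at hw0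
    have hc0 := (mul_eq_zero.mp hw0).resolve_right hP
    funext x
    rw [hc, hc0, zero_mul, Pi.zero_apply]
  have hmem := alternant_update_mem (V := thetaSpace p n) (fun j => (ψ j).2) (cubicPoint u w)
    (Fin.last _)
  simp only [update_cubicPoint_last] at hmem
  obtain ⟨c, hc⟩ := hu.exists_eq_const_mul hp hmem
    (fun k => alternant_eq_zero_of_eq (uIndex_ne_last k) (by
      change uVar (cubicPoint u (u k)) k = vVar (cubicPoint u (u k))
      rw [uVar_cubicPoint, vVar_cubicPoint]))
    (fun k => alternant_eq_zero_of_eq (tIndex_ne_last k) (by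
      change tVar (cubicPoint u (cubicRoot * u k)) k = vVar (cubicPoint u (cubicRoot * u k))
      rw [tVar_cubicPoint, vVar_cubicPoint]))
  refine ⟨u, _, hu, c, w, fun h0 => hD ?_, hP, hc⟩
  rw [hc, h0, zero_mul]

/-- The numerator of `Ψ_n` is a constant multiple of `trivialFactor p v ^ (n - 1)` times the
alternant: the quotient of the numerator by the alternant depends only on `v`, and it is found by
evaluating both at `cubicPoint u v`. -/
theorem exists_psiNumeratorVar_eq (hp : ‖(p : ℂ)‖ < 1) (hn : 1 ≤ n) {φ : Fin 3 → ℂˣ → ℂ}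
    (hφ : ∀ j, φ j ∈ thetaSpace p 1) (ψ : Module.Basis (Fin (2 * n + 1)) ℂ (thetaSpace p n)) :
    ∃ C : ℂ, ∀ x, psiNumeratorVar p n φ x =
      C * trivialFactor p (vVar x) ^ (n - 1) * alternant (fun j => (ψ j : ℂˣ → ℂ)) x := by
  obtain ⟨u, s, hu, c, w, hc, hw, hD⟩ := exists_alternant_cubicPoint hp ψ
  obtain ⟨d, hd⟩ := exists_psiNumeratorVar_cubicPoint hp hφ hu
  set D := alternant (fun j => (ψ j : ℂˣ → ℂ)) with hD_def
  have hND : ∀ v, psiNumeratorVar p n φ (cubicPoint u v) =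
      d / c * trivialFactor p v ^ (n - 1) * D (cubicPoint u v) := by
    intro v
    obtain ⟨m, rfl⟩ : ∃ m, n = m + 1 := ⟨n - 1, by omega⟩
    rw [hd, hD, add_tsub_cancel_right, pow_succ]
    field_simp
  have hhol : ∀ x, HolomorphicOnUnits fun z => D (update x (Fin.last _) z) := fun x =>
    (alternant_update_mem (V := thetaSpace p n) (fun j => (ψ j).2) x (Fin.last _)).1.holomorphic
  refine ⟨d / c, fun x => ?_⟩
  by_contra hne
  have hN : HolomorphicOnUnits fun z => psiNumeratorVar p n φ (update x (Fin.last _) z) := by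
    simp only [psiNumeratorVar, tVar_update_last, uVar_update_last, vVar_update_last]
    exact holomorphicOnUnits_psiNumerator hφ _ _
  have hE : HolomorphicOnUnits fun z => D (cubicPoint u z) := by
    simpa only [update_cubicPoint_last] using hhol (cubicPoint u w)
  obtain ⟨z, hz, hz'⟩ := (hN.sub (((HolomorphicOnUnits.const (d / c)).mul
    ((holomorphicOnUnits_trivialFactor hp).pow (n - 1))).mul (hhol x))).exists_ne_zero_and_ne_zero
    hE (x := vVar x) (y := w) (by
      have e : update x (Fin.last _) (vVar x) = x := update_eq_self _ _
      rw [e]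
      exact sub_ne_zero.mpr hne) (by
      rw [hD]
      exact mul_ne_zero hc hw)
  have key := mul_alternant_eq_mul_alternant ψ (F := psiNumeratorVar p n φ)
    (fun x i j => psiNumeratorVar_eq_zero_of_eq) (fun f hf => hf.1.holomorphic)
    (Finset.univ.erase (Fin.last _))
    (fun i hi => psiNumeratorVar_update_mem hp hφ (Finset.ne_of_mem_erase hi))
    (x := update x (Fin.last _) z) (y := cubicPoint u z) (fun i hi => by
      obtain rfl : i = Fin.last _ := by simpa using hi
      rw [update_self]
      exact (vVar_cubicPoint u z).symm) hz'
  rw [hND, ← hD_def] at key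
  refine hz (sub_eq_zero.mpr (mul_right_cancel₀ hz' ?_))
  rw [key]
  ring

/-! ### Density of the regular points -/

lemma dense_setOf_ne_zero_of_update {m : ℕ} {G : (Fin m → ℂˣ) → ℂ} (i : Fin m)
    (hG : ∀ x, HolomorphicOnUnits fun z => G (update x i z)) (h : ∀ x, ∃ z, G (update x i z) ≠ 0) :
    Dense {x | G x ≠ 0} := by
  intro x
  rw [mem_closure_iff]
  intro U hU hx
  obtain ⟨z, hz⟩ := h x
  obtain ⟨w, hw, hw'⟩ := ((hG x).dense_ne_zero hz).inter_open_nonempty _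
    (hU.preimage (continuous_const.update i continuous_id : Continuous fun z => update x i z))
    ⟨x i, by simpa using hx⟩
  exact ⟨_, hw, hw'⟩

lemma exists_cauchyDenom_ne_zero (hp : ‖(p : ℂ)‖ < 1) (u : ℂˣ) : ∃ t, cauchyDenom p t u ≠ 0 := by
  set L := Real.log ‖(p : ℂ)‖ with hL
  have hL0 : L ≠ 0 := (log_norm_neg hp).ne
  set a := Real.log ‖(u : ℂ)‖ / L with ha
  obtain ⟨r, hr⟩ := (((Set.countable_range fun k : ℤ => 2 * (k : ℝ) - a).union
    (Set.countable_range fun k : ℤ => a - 2 * (k : ℝ))).dense_compl ℝ).nonempty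
  obtain ⟨t, ht⟩ := exists_log_norm_eq p r
  refine ⟨t, fun h0 => hr ?_⟩
  have hu : Real.log ‖(u : ℂ)‖ = a * L := by rw [ha, div_mul_cancel₀ _ hL0]
  obtain ⟨k, hk | hk⟩ := log_norm_of_cauchyDenom_eq_zero hp h0 <;> rw [hu, ht, ← hL] at hk
  · exact .inl ⟨k, mul_right_cancel₀ hL0 (by linarith)⟩
  · exact .inr ⟨k, mul_right_cancel₀ hL0 (by linarith)⟩

lemma continuous_ellTheta_comp {X : Type*} [TopologicalSpace X] {q : ℂ} (hq : ‖q‖ < 1) {a : X → ℂ}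
    (ha : Continuous a) (h0 : ∀ x, a x ≠ 0) : Continuous fun x => ellTheta q (a x) :=
  continuous_iff_continuousAt.mpr fun x =>
    ((differentiableAt_ellTheta hq (h0 x)).continuousAt (x := a x)).comp ha.continuousAt

lemma continuous_cauchyDenom_comp (hp : ‖(p : ℂ)‖ < 1) {X : Type*} [TopologicalSpace X]
    {a b : X → ℂˣ} (ha : Continuous a) (hb : Continuous b) :
    Continuous fun x => cauchyDenom p (a x) (b x) := by
  have hp6 := norm_pow_lt_one hp (k := 6) (by norm_num)
  have ha3 : Continuous fun x => (a x : ℂ) ^ 3 := (Units.continuous_val.comp ha).pow 3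
  have hb3 : Continuous fun x => (b x : ℂ) ^ 3 := (Units.continuous_val.comp hb).pow 3
  have ha0 : ∀ x, (a x : ℂ) ^ 3 ≠ 0 := fun x => pow_ne_zero 3 (a x).ne_zero
  have hb0 : ∀ x, (b x : ℂ) ^ 3 ≠ 0 := fun x => pow_ne_zero 3 (b x).ne_zero
  exact (hb3.inv₀ hb0).mul ((continuous_ellTheta_comp hp6 (hb3.mul ha3)
    fun x => mul_ne_zero (hb0 x) (ha0 x)).mul (continuous_ellTheta_comp hp6
      (hb3.mul (ha3.inv₀ ha0)) fun x => mul_ne_zero (hb0 x) (inv_ne_zero (ha0 x))))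

lemma dense_psiRegular (hp : ‖(p : ℂ)‖ < 1) (n : ℕ) : Dense (psiRegular p n) := by
  have h1 : Dense (⋂ k : Fin n × Fin n,
      {x : Fin (2 * n + 1) → ℂˣ | cauchyDenom p (tVar x k.1) (uVar x k.2) ≠ 0}) := by
    refine dense_iInter_of_isOpen (fun k => ?_) fun k => ?_
    · exact isOpen_ne_fun (continuous_cauchyDenom_comp hp (continuous_apply (tIndex k.1))
        (continuous_apply (uIndex k.2))) continuous_const
    · refine dense_setOf_ne_zero_of_update (tIndex k.1) (fun x => ?_) fun x => ?_
      · simp only [tVar_update_tIndex, uVar_update_tIndex, update_self]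
        exact holomorphicOnUnits_cauchyDenom_left hp _
      · simp only [tVar_update_tIndex, uVar_update_tIndex, update_self]
        exact exists_cauchyDenom_ne_zero hp _
  have h2 : Dense {x : Fin (2 * n + 1) → ℂˣ | trivialFactor p (vVar x) ^ (n - 1) ≠ 0} := by
    refine dense_setOf_ne_zero_of_update (Fin.last _) (fun x => ?_) fun x => ?_
    · simp only [vVar_update_last]
      exact (holomorphicOnUnits_trivialFactor hp).pow _
    · simp only [vVar_update_last]
      obtain ⟨u, s, hu⟩ := exists_isGeneric p 1
      exact ⟨u 0, pow_ne_zero _ (hu.trivialFactor_ne_zero hp 0)⟩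
  have ho : IsOpen {x : Fin (2 * n + 1) → ℂˣ | trivialFactor p (vVar x) ^ (n - 1) ≠ 0} :=
    isOpen_ne_fun (((holomorphicOnUnits_trivialFactor hp).continuous.comp
      (continuous_apply (Fin.last _))).pow _) continuous_const
  convert h1.inter_of_isOpen_right h2 ho using 1
  ext x
  simp [psiRegular, Prod.forall]

end

end

/-! ### The determinant formula for `Ψ_n` -/

theorem mainTheorem8 (p : ℂˣ) (hp : ‖(p : ℂ)‖ < 1) (n : ℕ) (hn : 1 ≤ n)
    (φ : Module.Basis (Fin 3) ℂ (thetaSpace p 1))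
    (ψ : Module.Basis (Fin (2 * n + 1)) ℂ (thetaSpace p n)) :
    -- the quotient defining `Ψ_n` extends from the dense set where it is meaningful
    (Dense (psiRegular p n) ∧
      ∀ x ∈ psiRegular p n,
        bigPsi p n (fun j => (φ j : ℂˣ → ℂ)) x = psiQuotient p n (fun j => (φ j : ℂˣ → ℂ)) x) ∧
    -- `Ψ_n` is a constant multiple of the alternant of a basis of `V_n`
    (∃ C : ℂ, ∀ x : Fin (2 * n + 1) → ℂˣ,
      bigPsi p n (fun j => (φ j : ℂˣ → ℂ)) x = C * alternant (fun j => (ψ j : ℂˣ → ℂ)) x) ∧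
    -- `Ψ_n` is antisymmetric in all its variables
    (∀ (σ : Equiv.Perm (Fin (2 * n + 1))) (x : Fin (2 * n + 1) → ℂˣ),
      bigPsi p n (fun j => (φ j : ℂˣ → ℂ)) (x ∘ σ) =
        ((Equiv.Perm.sign σ : ℤ) : ℂ) * bigPsi p n (fun j => (φ j : ℂˣ → ℂ)) x) := by
  have hdense := dense_psiRegular hp n
  obtain ⟨C, hC⟩ := exists_psiNumeratorVar_eq hp hn (fun j => (φ j).2) ψ
  have hquot : ∀ x ∈ psiRegular p n, psiQuotient p n (fun j => (φ j : ℂˣ → ℂ)) x =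
      C * alternant (fun j => (ψ j : ℂˣ → ℂ)) x := by
    intro x hx
    have hT := hx.2
    have h := hC x
    rw [psiNumeratorVar] at h
    rw [psiQuotient_eq hx, h]
    field_simp
  have hcont : Continuous fun x => C * alternant (fun j => (ψ j : ℂˣ → ℂ)) x :=
    continuous_const.mul (continuous_alternant fun j => (ψ j).2.1.holomorphic.continuous)
  have hmain : ∀ x, bigPsi p n (fun j => (φ j : ℂˣ → ℂ)) x =
      C * alternant (fun j => (ψ j : ℂˣ → ℂ)) x := fun x =>
    extendFrom_eq (hdense x) ((hcont.continuousWithinAt (s := psiRegular p n)).congr'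
      (eventually_nhdsWithin_of_forall fun y hy => (hquot y hy).symm))
  refine ⟨⟨hdense, fun x hx => by rw [hmain, hquot x hx]⟩, ⟨C, hmain⟩, fun σ x => ?_⟩
  rw [hmain, hmain, alternant_comp_perm, mul_left_comm]
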